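/- **Setting.** Let $\tau>0$, let $X$ be a complex Banach space and $U_0,U_{d0},Y_0$ complex Hilbert spaces, and write $U=L^2(0,\tau;U_0)$, $U_d=L^2(0,\tau;U_{d0})$, $Y=L^2(0,\tau;Y_0)$. A $\tau$-periodic system $\dot x=A(t)x+B(t)u+B_d(t)w$, $y=C(t)x+D(t)u$ is given by a strongly continuous evolution family $U_A(t,s)\in\mathcal L(X)$, $t\ge s$, with $U_A(t,t)=I$, $U_A(t,r)U_A(r,s)=U_A(t,s)$ for $t\ge r\ge s$ and $U_A(t+\tau,s+\tau)=U_A(t,s)$, and by $\tau$-periodic $B\in L^\infty(\mathbb R,\mathcal L(U_0,X))$, $B_d\in L^\infty(\mathbb R,\mathcal L(U_{d0},X))$, $C\in L^\infty(\mathbb R,\mathcal L(X,Y_0))$, $D\in L^\infty(\mathbb R,\mathcal L(U_0,Y_0))$. Its mild state is $$x(t)=U_A(t,0)x_0+\int_0^tU_A(t,s)\bigl(B(s)u(s)+B_d(s)w(s)\bigr)\,ds .$$ It is exponentially stable if $\|U_A(t,s)\|\le Me^{-\omega(t-s)}$ for all $t\ge s$ and some $M,\omega>0$. If $1\in\rho(U_A(\tau,0))$,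 put $G_A(t,s)=U_A(t,0)(I-U_A(\tau,0))^{-1}U_A(\tau,s)$ and define $\mathcal P\in\mathcal L(U,Y)$, $\mathcal P_d\in\mathcal L(U_d,Y)$ by $$\mathcal Pu=C(\cdot)\int_0^\tau G_A(\cdot,s)B(s)u(s)\,ds+C(\cdot)\int_0^{\,\cdot}U_A(\cdot,s)B(s)u(s)\,ds+D(\cdot)u(\cdot),$$ $$\mathcal P_dw=C(\cdot)\int_0^\tau G_A(\cdot,s)B_d(s)w(s)\,ds+C(\cdot)\int_0^{\,\cdot}U_A(\cdot,s)B_d(s)w(s)\,ds .$$ For $G_1\in\mathcal L(Z)$, $G_2\in\mathcal L(Y,Z)$, $K\in\mathcal L(Z,U)$, the controller $(G_1,G_2,K)$ on $Z$ is $$z_{n+1}=G_1z_n+G_2e_n,\qquad u(n\tau+\cdot)=Kz_n\ \text{ on } [0,\tau),\qquad e_n=y(n\tau+\cdot)-y_{ref}(\cdot)\in Y,\qquad n\ge0,$$ with initial state $z_0\in Z$. The reference $y_{ref}$ and the disturbance $w=w_{dist}$ are $\tau$-periodic and are identified with elements of $Y$ and $U_d$. The closed loop is exponentially stable if there are $M_0,M_1,\alpha_0,\alpha_1>0$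 such that, for $y_{ref}=0$ and $w_{dist}=0$, $\|x(t)\|\le M_0e^{-\alpha_0t}(\|x_0\|+\|z_0\|)$ and $\|z_n\|\le M_1e^{-\alpha_1n}(\|x_0\|+\|z_0\|)$ for all $t\ge0$, $n\ge0$, $x_0\in X$, $z_0\in Z$. We say that the regulation error converges to $e_\infty(y_{ref},w_{dist})\in Y$ if there are $M,\alpha>0$ with $$\|e_n-e_\infty(y_{ref},w_{dist})\|_Y\le Me^{-\alpha n}\bigl(\|x_0\|+\|z_0\|+\|y_{ref}\|_Y+\|w_{dist}\|_{U_d}\bigr)$$ for all $n\ge0$, all $x_0\in X$, $z_0\in Z$ and all $\tau$-periodic signals $y_{ref}\in Y$, $w_{dist}\in U_d$; in particular then $\|y(n\tau+\cdot)-y_{ref}(\cdot)\|_Y\to\|e_\infty(y_{ref},w_{dist})\|_Y$ as $n\to\infty$. **Theorem.** Assume that the periodic system is exponentially stable. Let $Y_N\subset Y$ be a finite-dimensional subspace with $Y_N\subset\operatorname{ran}(\mathcal P)$, let $r=\dim Y_N$, and let $Q_N$ be a bounded projection of $Y$ onto $Y_N$. Let $G_{20}\in\mathcal L(Y_N,\mathbb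 C^r)$ be boundedly invertible, and let $K_0\in\mathcal L(\mathbb C^r,U)$ be such that $\sigma(G_{20}Q_N\mathcal PK_0)\subset\mathbb C_-=\{\lambda:\operatorname{Re}\lambda<0\}$. On $Z=\mathbb C^r$ consider the controller $$G_1=I,\qquad G_2=G_{20}Q_N,\qquad K=\varepsilon K_0 .$$ Then there is $\varepsilon^*>0$ such that for every $0<\varepsilon\le\varepsilon^*$ the following hold. 1. For all initial states and all $\tau$-periodic $y_{ref}\in Y$, $w_{dist}\in U_d$ the closed-loop system has a trajectory. The closed loop is exponentially stable. For all such signals the equation $Q_N\mathcal PKz=Q_Ny_{ref}-Q_N\mathcal P_dw_{dist}$ has a unique solution $z\in Z$, and the regulation error converges to $$(I-Q_N)\bigl[\mathcal PKz+\mathcal P_dw_{dist}-y_{ref}\bigr].$$ 2. (Robustness.) Suppose that the system is replaced by any $\tau$-periodic system of the above form, with the same spaces $X,U_0,U_{d0},Y_0$, for which the closed loop with the same controller is exponentially stable. Then for all initial states and all $\tau$-periodic signals the perturbed closed loop has a trajectory, and its regulation error converges to some $e_\infty(y_{ref},w_{dist})$ with $Q_Ne_\infty(y_{ref},w_{dist})=0$.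 If moreover $1\in\rho(U_{\tilde A}(\tau,0))$ for the perturbed evolution family, then the assertions of part 1 on the unique solution $z$ and on the limit of the regulation error hold with $\mathcal P,\mathcal P_d$ replaced by the operators $\tilde{\mathcal P},\tilde{\mathcal P}_d$ of the perturbed system. -/

import Mathlib

open MeasureTheory Set Filter Topology
open scoped ENNReal

noncomputable section

/-- Lebesgue measure on one period `(0, τ]` (the end points are null sets). -/
abbrev periodMeasure (τ : ℝ) : Measure ℝ := volume.restrict (Ioc 0 τ)

/-- The space `L²(0, τ; V)`. -/
abbrev L2 (τ : ℝ) (V : Type*) [NormedAddCommGroup V] := Lp V 2 (periodMeasure τ)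

/-- A strongly continuous evolution family `U(t,s)`, `t ≥ s`, of bounded operators on `X` that is
`τ`-periodic: `U(t+τ,s+τ) = U(t,s)`.  Only the values at `s ≤ t` matter. -/
structure PeriodicEvolutionFamily (τ : ℝ) (X : Type*) [NormedAddCommGroup X]
    [NormedSpace ℂ X] where
  period_pos : 0 < τ
  evol : ℝ → ℝ → X →L[ℂ] X
  evol_self : ∀ t, evol t t = ContinuousLinearMap.id ℂ X
  evol_comp : ∀ t r s, s ≤ r → r ≤ t → evol t r ∘L evol r s = evol t s
  evol_cont : ∀ x : X, ContinuousOn (fun p : ℝ × ℝ => evol p.1 p.2 x) {p | p.2 ≤ p.1}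
  evol_periodic : ∀ t s, s ≤ t → evol (t + τ) (s + τ) = evol t s

namespace PeriodicEvolutionFamily

variable {τ : ℝ} {X : Type*} [NormedAddCommGroup X] [NormedSpace ℂ X]

/-- Exponential stability: `‖U(t,s)‖ ≤ M e^{-ω (t-s)}` for all `t ≥ s`. -/
def ExponentiallyStable (E : PeriodicEvolutionFamily τ X) : Prop :=
  ∃ M > 0, ∃ ω > 0, ∀ t s, s ≤ t → ‖E.evol t s‖ ≤ M * Real.exp (-ω * (t - s))

/-- `(I - U(τ,0))⁻¹`, meaningful when `1` lies in the resolvent set of `U(τ,0)`. -/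
def monodromyResolvent (E : PeriodicEvolutionFamily τ X) : X →L[ℂ] X :=
  Ring.inverse (ContinuousLinearMap.id ℂ X - E.evol τ 0)

/-- The kernel `G(t,s) = U(t,0) (I - U(τ,0))⁻¹ U(τ,s)`. -/
def green (E : PeriodicEvolutionFamily τ X) (t s : ℝ) : X →L[ℂ] X :=
  E.evol t 0 ∘L E.monodromyResolvent ∘L E.evol τ s

/-- `∫₀^τ G(t,s) g(s) ds + ∫₀ᵗ U(t,s) g(s) ds`. -/
def steadyState (E : PeriodicEvolutionFamily τ X) (g : ℝ → X) (t : ℝ) : X :=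
  (∫ s in (0 : ℝ)..τ, E.green t s (g s)) + ∫ s in (0 : ℝ)..t, E.evol t s (g s)

/-! The map `g ↦ steadyState g` is a bounded operator on `L²(0, τ; X)`. -/

theorem exists_bound [CompleteSpace X] (E : PeriodicEvolutionFamily τ X) :
    ∃ M : NNReal, ∀ t s, 0 ≤ s → s ≤ t → t ≤ τ → ‖E.evol t s‖ ≤ M := by
  let S : Set (ℝ × ℝ) := {p | 0 ≤ p.2 ∧ p.2 ≤ p.1 ∧ p.1 ≤ τ}
  have hS : IsCompact S := by
    refine (isCompact_Icc (a := ((0, 0) : ℝ × ℝ)) (b := (τ, τ))).of_isClosed_subset ?_ ?_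
    · exact (isClosed_le continuous_const continuous_snd).inter
        ((isClosed_le continuous_snd continuous_fst).inter
          (isClosed_le continuous_fst continuous_const))
    · rintro ⟨t, s⟩ ⟨h1, h2, h3⟩
      simp only at h1 h2 h3
      exact ⟨⟨h1.trans h2, h1⟩, ⟨h3, h2.trans h3⟩⟩
  obtain ⟨C, hC⟩ := banach_steinhaus (g := fun p : S => E.evol p.1.1 p.1.2) (fun x => by
    obtain ⟨C, hC⟩ := hS.exists_bound_of_continuousOn
      ((E.evol_cont x).mono (fun p hp => hp.2.1))
    exact ⟨C, fun p => hC p.1 p.2⟩)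
  exact ⟨C.toNNReal, fun t s h0 hs ht =>
    (hC ⟨(t, s), h0, hs, ht⟩).trans (Real.le_coe_toNNReal C)⟩

/-- The evolution family on `0 ≤ s ≤ t ≤ τ`, extended continuously to all `(t, s)`. -/
def clamped (E : PeriodicEvolutionFamily τ X) (q : (ℝ × ℝ) × X) : X :=
  E.evol (max 0 (min q.1.1 τ)) (min (max 0 (min q.1.2 τ)) (max 0 (min q.1.1 τ))) q.2

theorem clamped_eq (E : PeriodicEvolutionFamily τ X) {t s : ℝ} (h0 : 0 ≤ s) (hs : s ≤ t)
    (ht : t ≤ τ) (x : X) : E.clamped ((t, s), x) = E.evol t s x := by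
  simp [clamped, min_eq_left ht, min_eq_left (hs.trans ht), max_eq_right h0,
    max_eq_right (h0.trans hs), min_eq_left hs]

theorem continuous_clamped [CompleteSpace X] (E : PeriodicEvolutionFamily τ X) :
    Continuous E.clamped := by
  obtain ⟨M, hM⟩ := E.exists_bound
  refine continuous_prod_of_continuous_lipschitzWith' _ M (fun p => ?_) (fun x => ?_)
  · refine LipschitzWith.of_dist_le_mul fun x y => ?_
    simp only [clamped, dist_eq_norm, ← map_sub]
    refine (ContinuousLinearMap.le_opNorm _ _).trans ?_
    gcongr
    exact hM _ _ (le_min (le_max_left _ _) (le_max_left _ _)) (min_le_right _ _)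
      (max_le E.period_pos.le (min_le_right _ _))
  · have h : Continuous fun p : ℝ × ℝ =>
        (max 0 (min p.1 τ), min (max 0 (min p.2 τ)) (max 0 (min p.1 τ))) := by fun_prop
    have h' : ∀ p : ℝ × ℝ,
        min (max 0 (min p.2 τ)) (max 0 (min p.1 τ)) ≤ max 0 (min p.1 τ) :=
      fun p => min_le_right _ _
    exact (E.evol_cont x).comp_continuous h h'

/-- The combined kernel of the two integrals in `steadyState`. -/
def kernel (E : PeriodicEvolutionFamily τ X) (t s : ℝ) (x : X) : X :=
  E.green t s x + if s ≤ t then E.evol t s x else 0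

theorem kernel_bound [CompleteSpace X] (E : PeriodicEvolutionFamily τ X) :
    ∃ M : ℝ, 0 ≤ M ∧ ∀ t ∈ Ioc 0 τ, ∀ s ∈ Ioc 0 τ, ∀ x, ‖E.kernel t s x‖ ≤ M * ‖x‖ := by
  obtain ⟨M, hM⟩ := E.exists_bound
  refine ⟨M * (‖E.monodromyResolvent‖ * M) + M, by positivity, fun t ht s hs x => ?_⟩
  rw [add_mul]
  refine (norm_add_le _ _).trans (add_le_add ?_ ?_)
  · refine ContinuousLinearMap.le_of_opNorm_le _ ?_ _
    refine (ContinuousLinearMap.opNorm_comp_le _ _).trans ?_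
    gcongr
    · exact hM _ _ le_rfl ht.1.le ht.2
    · refine (ContinuousLinearMap.opNorm_comp_le _ _).trans ?_
      gcongr
      exact hM _ _ hs.1.le hs.2 le_rfl
  · split_ifs with h
    · exact ContinuousLinearMap.le_of_opNorm_le _ (hM _ _ hs.1.le h ht.2) _
    · simp; positivity

theorem green_eq (E : PeriodicEvolutionFamily τ X) {t s : ℝ} (ht : t ∈ Ioc 0 τ)
    (hs : s ∈ Ioc 0 τ) (x : X) : E.green t s x =
      E.clamped ((t, 0), E.monodromyResolvent (E.clamped ((τ, s), x))) := by
  rw [E.clamped_eq le_rfl ht.1.le ht.2, E.clamped_eq hs.1.le hs.2 le_rfl]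
  rfl

theorem aestronglyMeasurable_green [CompleteSpace X] (E : PeriodicEvolutionFamily τ X) {g : ℝ → X}
    (hg : AEStronglyMeasurable g (periodMeasure τ)) {t : ℝ} (ht : t ∈ Ioc 0 τ) :
    AEStronglyMeasurable (fun s => E.green t s (g s)) (periodMeasure τ) := by
  have hc := E.continuous_clamped
  have h1 : Continuous fun q : ℝ × X =>
      E.clamped ((t, 0), E.monodromyResolvent (E.clamped ((τ, q.1), q.2))) := by fun_prop
  have h2 := h1.comp_aestronglyMeasurable (aestronglyMeasurable_id.prodMk hg)
  refine h2.congr ?_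
  filter_upwards [ae_restrict_mem measurableSet_Ioc] with s hs
  exact (E.green_eq ht hs _).symm

theorem aestronglyMeasurable_evol [CompleteSpace X] (E : PeriodicEvolutionFamily τ X) {g : ℝ → X}
    (hg : AEStronglyMeasurable g (periodMeasure τ)) {t : ℝ} (ht : t ∈ Ioc 0 τ) :
    AEStronglyMeasurable (fun s => if s ≤ t then E.evol t s (g s) else 0) (periodMeasure τ) := by
  have hc := E.continuous_clamped
  have h1 : Continuous fun q : ℝ × X => E.clamped ((t, q.1), q.2) := by fun_prop
  have h2 := h1.comp_aestronglyMeasurable (aestronglyMeasurable_id.prodMk hg)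
  refine (h2.indicator (measurableSet_Iic (a := t))).congr ?_
  filter_upwards [ae_restrict_mem measurableSet_Ioc] with s hs
  by_cases h : s ≤ t
  · simp [h, E.clamped_eq hs.1.le h ht.2]
  · simp [h]

theorem aestronglyMeasurable_kernel_prod [CompleteSpace X] (E : PeriodicEvolutionFamily τ X)
    {g : ℝ → X} (hg : AEStronglyMeasurable g (periodMeasure τ)) :
    AEStronglyMeasurable (fun p : ℝ × ℝ => E.kernel p.1 p.2 (g p.2))
      ((periodMeasure τ).prod (periodMeasure τ)) := by
  have hc := E.continuous_clamped
  have h0 : AEStronglyMeasurable (fun p : ℝ × ℝ => (p, g p.2))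
      ((periodMeasure τ).prod (periodMeasure τ)) := aestronglyMeasurable_id.prodMk hg.comp_snd
  have h1 : Continuous fun q : (ℝ × ℝ) × X =>
      E.clamped ((q.1.1, 0), E.monodromyResolvent (E.clamped ((τ, q.1.2), q.2))) := by fun_prop
  have h2 := (h1.comp_aestronglyMeasurable h0).add ((hc.comp_aestronglyMeasurable h0).indicator
    (measurableSet_le measurable_snd measurable_fst))
  refine h2.congr ?_
  rw [Measure.prod_restrict]
  filter_upwards [ae_restrict_mem (measurableSet_Ioc.prod measurableSet_Ioc)] with p hp
  by_cases h : p.2 ≤ p.1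
  · simp [kernel, h, E.green_eq hp.1 hp.2, E.clamped_eq hp.2.1.le h hp.1.2]
  · simp [kernel, h, E.green_eq hp.1 hp.2]

theorem integrable_kernel [CompleteSpace X] (E : PeriodicEvolutionFamily τ X) {g : ℝ → X}
    (hg : Integrable g (periodMeasure τ)) {t : ℝ} (ht : t ∈ Ioc 0 τ) :
    Integrable (fun s => E.kernel t s (g s)) (periodMeasure τ) := by
  obtain ⟨M, -, hM⟩ := E.kernel_bound
  refine (hg.norm.const_mul M).mono' ((E.aestronglyMeasurable_green hg.1 ht).add
    (E.aestronglyMeasurable_evol hg.1 ht)) ?_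
  filter_upwards [ae_restrict_mem measurableSet_Ioc] with s hs
  exact hM t ht s hs _

theorem steadyState_eq [CompleteSpace X] (E : PeriodicEvolutionFamily τ X) {g : ℝ → X}
    (hg : Integrable g (periodMeasure τ)) {t : ℝ} (ht : t ∈ Ioc 0 τ) :
    E.steadyState g t = ∫ s, E.kernel t s (g s) ∂(periodMeasure τ) := by
  have hG : Integrable (fun s => E.green t s (g s)) (periodMeasure τ) := by
    obtain ⟨M, hM⟩ := E.exists_bound
    refine (hg.norm.const_mul (M * (‖E.monodromyResolvent‖ * M))).mono'
      (E.aestronglyMeasurable_green hg.1 ht) ?_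
    filter_upwards [ae_restrict_mem measurableSet_Ioc] with s hs
    refine ContinuousLinearMap.le_of_opNorm_le _ ?_ _
    refine (ContinuousLinearMap.opNorm_comp_le _ _).trans ?_
    gcongr
    · exact hM _ _ le_rfl ht.1.le ht.2
    · refine (ContinuousLinearMap.opNorm_comp_le _ _).trans ?_
      gcongr
      exact hM _ _ hs.1.le hs.2 le_rfl
  have hV : Integrable (fun s => if s ≤ t then E.evol t s (g s) else 0) (periodMeasure τ) := by
    have := (E.integrable_kernel hg ht).sub hG
    refine this.congr (ae_of_all _ fun s => ?_)
    simp [kernel]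
  unfold kernel
  rw [integral_add hG hV, steadyState, intervalIntegral.integral_of_le E.period_pos.le,
    intervalIntegral.integral_of_le ht.1.le]
  congr 1
  have : (fun s => if s ≤ t then E.evol t s (g s) else 0) =
      (Iic t).indicator fun s => E.evol t s (g s) := by
    ext s; simp [indicator]
  rw [this, integral_indicator measurableSet_Iic, Measure.restrict_restrict measurableSet_Iic]
  congr 2
  ext s
  simp only [mem_Ioc, mem_inter_iff, mem_Iic]
  constructor
  · rintro ⟨h1, h2⟩; exact ⟨h2, h1, h2.trans ht.2⟩
  · rintro ⟨h1, h2, -⟩; exact ⟨h2, h1⟩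

theorem steadyState_memLp [CompleteSpace X] (E : PeriodicEvolutionFamily τ X) :
    ∃ c : ℝ, 0 ≤ c ∧ ∀ g : L2 τ X, MemLp (E.steadyState g) 2 (periodMeasure τ) ∧
      ∀ t ∈ Ioc 0 τ, ‖E.steadyState g t‖ ≤ c * ‖g‖ := by
  obtain ⟨M, hM0, hM⟩ := E.kernel_bound
  obtain ⟨c, hc0, hc⟩ : ∃ c : ℝ, 0 ≤ c ∧ ∀ g : L2 τ X,
      ∫ s, ‖g s‖ ∂(periodMeasure τ) ≤ c * ‖g‖ := by
    refine ⟨((periodMeasure τ) univ ^ (1 / (1 : ℝ≥0∞).toReal - 1 / (2 : ℝ≥0∞).toReal)).toReal,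
      by positivity, fun g => ?_⟩
    have h := eLpNorm_le_eLpNorm_mul_rpow_measure_univ (μ := periodMeasure τ)
      (p := 1) (q := 2) (by norm_num) (Lp.aestronglyMeasurable g)
    rw [eLpNorm_one_eq_lintegral_enorm] at h
    rw [integral_norm_eq_lintegral_enorm (Lp.aestronglyMeasurable g), Lp.norm_def, mul_comm,
      ← ENNReal.toReal_mul]
    refine ENNReal.toReal_mono (ENNReal.mul_ne_top (Lp.memLp g).2.ne ?_) h
    exact ENNReal.rpow_ne_top_of_nonneg (by norm_num) (measure_ne_top _ _)
  have hbd : ∀ g : L2 τ X, ∀ t ∈ Ioc 0 τ, ‖E.steadyState g t‖ ≤ M * c * ‖g‖ := by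
    intro g t ht
    have hg : Integrable g (periodMeasure τ) := (Lp.memLp g).integrable (by norm_num)
    rw [E.steadyState_eq hg ht]
    refine (norm_integral_le_of_norm_le (hg.norm.const_mul M) ?_).trans ?_
    · filter_upwards [ae_restrict_mem measurableSet_Ioc] with s hs
      exact hM t ht s hs _
    · rw [integral_const_mul, mul_assoc]
      exact mul_le_mul_of_nonneg_left (hc g) hM0
  refine ⟨M * c, by positivity, fun g => ⟨?_, hbd g⟩⟩
  have hg : Integrable g (periodMeasure τ) := (Lp.memLp g).integrable (by norm_num)
  refine MemLp.of_bound ?_ (M * c * ‖g‖) ?_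
  · refine (E.aestronglyMeasurable_kernel_prod hg.1).integral_prod_right'.congr ?_
    filter_upwards [ae_restrict_mem measurableSet_Ioc] with t ht
    exact (E.steadyState_eq hg ht).symm
  · filter_upwards [ae_restrict_mem measurableSet_Ioc] with t ht
    exact hbd g t ht

/-- `g ↦ steadyState g` as a bounded operator on `L²(0, τ; X)`. -/
def steadyStateOp [CompleteSpace X] (E : PeriodicEvolutionFamily τ X) : L2 τ X →L[ℂ] L2 τ X :=
  LinearMap.mkContinuousOfExistsBound
    { toFun := fun g => (E.steadyState_memLp.choose_spec.2 g).1.toLp (E.steadyState g)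
      map_add' := fun f g => by
        rw [← MemLp.toLp_add]
        refine MemLp.toLp_congr _ _ ?_
        filter_upwards [ae_restrict_mem measurableSet_Ioc] with t ht
        have hf : Integrable f (periodMeasure τ) := (Lp.memLp f).integrable (by norm_num)
        have hg : Integrable g (periodMeasure τ) := (Lp.memLp g).integrable (by norm_num)
        have hfg : Integrable (f + g : L2 τ X) (periodMeasure τ) :=
          (Lp.memLp (f + g)).integrable (by norm_num)
        rw [Pi.add_apply, E.steadyState_eq hf ht, E.steadyState_eq hg ht,
          E.steadyState_eq hfg ht,
          ← integral_add (E.integrable_kernel hf ht) (E.integrable_kernel hg ht)]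
        refine integral_congr_ae ?_
        filter_upwards [Lp.coeFn_add f g] with s hs
        rw [hs]
        simp only [kernel, Pi.add_apply, map_add]
        split_ifs <;> abel
      map_smul' := fun a g => by
        rw [RingHom.id_apply, ← MemLp.toLp_const_smul]
        refine MemLp.toLp_congr _ _ ?_
        filter_upwards [ae_restrict_mem measurableSet_Ioc] with t ht
        have hg : Integrable g (periodMeasure τ) := (Lp.memLp g).integrable (by norm_num)
        have hag : Integrable (a • g : L2 τ X) (periodMeasure τ) :=
          (Lp.memLp (a • g)).integrable (by norm_num)
        rw [Pi.smul_apply, E.steadyState_eq hg ht, E.steadyState_eq hag ht, ← integral_smul]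
        refine integral_congr_ae ?_
        filter_upwards [Lp.coeFn_smul a g] with s hs
        rw [hs]
        simp only [kernel, Pi.smul_apply, map_smul, smul_add]
        split_ifs <;> simp }
    (by
      obtain ⟨c, hc0, hc⟩ := E.steadyState_memLp
      refine ⟨measureUnivNNReal (periodMeasure τ) ^ ((2 : ℝ≥0∞).toReal)⁻¹ * c, fun g => ?_⟩
      have h2 := Lp.norm_le_of_ae_bound (p := 2)
        (f := (hc g).1.toLp (E.steadyState g)) (C := c * ‖g‖) (by positivity) (by
          filter_upwards [(hc g).1.coeFn_toLp, ae_restrict_mem measurableSet_Ioc] with t h1 ht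
          rw [h1]; exact (hc g).2 t ht)
      rw [mul_assoc]
      exact h2)

theorem coeFn_steadyStateOp [CompleteSpace X] (E : PeriodicEvolutionFamily τ X) (g : L2 τ X) :
    E.steadyStateOp g =ᵐ[periodMeasure τ] E.steadyState g :=
  MemLp.coeFn_toLp (E.steadyState_memLp.choose_spec.2 g).1

theorem steadyState_congr (E : PeriodicEvolutionFamily τ X) {f g : ℝ → X}
    (h : f =ᵐ[periodMeasure τ] g) {t : ℝ} (ht : t ∈ Ioc 0 τ) :
    E.steadyState f t = E.steadyState g t := by
  rw [Filter.EventuallyEq, ae_restrict_iff' measurableSet_Ioc] at h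
  unfold steadyState
  congr 1
  · refine intervalIntegral.integral_congr_ae ?_
    filter_upwards [h] with s hs hs'
    rw [uIoc_of_le E.period_pos.le] at hs'
    rw [hs hs']
  · refine intervalIntegral.integral_congr_ae ?_
    filter_upwards [h] with s hs hs'
    rw [uIoc_of_le ht.1.le] at hs'
    rw [hs ⟨hs'.1, hs'.2.trans ht.2⟩]

end PeriodicEvolutionFamily

/-- Pointwise multiplication `(b u)(t) = b(t) u(t)` by an operator-valued function
`b ∈ L^∞(ℝ, L(V, W))`, as a bounded operator `L²(0, τ; V) → L²(0, τ; W)`. -/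
def mulOp (τ : ℝ) {V W : Type*} [NormedAddCommGroup V] [NormedSpace ℂ V] [NormedAddCommGroup W]
    [NormedSpace ℂ W] (b : ℝ → V →L[ℂ] W) (hb : MemLp b ∞ volume) : L2 τ V →L[ℂ] L2 τ W :=
  (ContinuousLinearMap.id ℂ (V →L[ℂ] W)).holderL (periodMeasure τ) ∞ 2 2 ((hb.restrict _).toLp b)

theorem coeFn_mulOp (τ : ℝ) {V W : Type*} [NormedAddCommGroup V] [NormedSpace ℂ V]
    [NormedAddCommGroup W] [NormedSpace ℂ W] (b : ℝ → V →L[ℂ] W) (hb : MemLp b ∞ volume)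
    (u : L2 τ V) : mulOp τ b hb u =ᵐ[periodMeasure τ] fun t => b t (u t) := by
  have h := (ContinuousLinearMap.id ℂ (V →L[ℂ] W)).coeFn_holder (r := 2)
    ((hb.restrict (Ioc 0 τ)).toLp b) u
  filter_upwards [h, (hb.restrict (Ioc 0 τ)).coeFn_toLp] with t h1 h2
  rw [h2] at h1
  exact h1

/-- The data of the `τ`-periodic linear system
`x' = A(t) x + B(t) u + B_d(t) w`, `y = C(t) x + D(t) u`
in its mild formulation: `A(·)` enters through the evolution family that it generates. -/
structure PeriodicSystem (τ : ℝ) (X U₀ Ud₀ Y₀ : Type*)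
    [NormedAddCommGroup X] [NormedSpace ℂ X]
    [NormedAddCommGroup U₀] [InnerProductSpace ℂ U₀]
    [NormedAddCommGroup Ud₀] [InnerProductSpace ℂ Ud₀]
    [NormedAddCommGroup Y₀] [InnerProductSpace ℂ Y₀]
    extends PeriodicEvolutionFamily τ X where
  B : ℝ → U₀ →L[ℂ] X
  Bd : ℝ → Ud₀ →L[ℂ] X
  C : ℝ → X →L[ℂ] Y₀
  D : ℝ → U₀ →L[ℂ] Y₀
  memLp_B : MemLp B ∞ volume
  memLp_Bd : MemLp Bd ∞ volume
  memLp_C : MemLp C ∞ volume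
  memLp_D : MemLp D ∞ volume
  periodic_B : Function.Periodic B τ
  periodic_Bd : Function.Periodic Bd τ
  periodic_C : Function.Periodic C τ
  periodic_D : Function.Periodic D τ

/-- A `τ`-periodic locally square integrable function. -/
structure PeriodicSignal (τ : ℝ) (V : Type*) [NormedAddCommGroup V] where
  toFun : ℝ → V
  periodic : Function.Periodic toFun τ
  memLp : MemLp toFun 2 (periodMeasure τ)

namespace PeriodicSignal

variable {τ : ℝ} {V : Type*} [NormedAddCommGroup V]

instance : CoeFun (PeriodicSignal τ V) (fun _ => ℝ → V) := ⟨toFun⟩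

/-- The restriction of a periodic signal to one period, in `L²(0, τ; V)`. -/
def toL2 (f : PeriodicSignal τ V) : L2 τ V := f.memLp.toLp f

instance : Zero (PeriodicSignal τ V) := ⟨⟨fun _ => 0, fun _ => rfl, MemLp.zero⟩⟩

end PeriodicSignal

/-- The parameters `(G₁, G₂, K)` of the discrete-time controller
`z_{n+1} = G₁ z_n + G₂ (y(nτ + ·) - y_ref)`, `u(nτ + ·) = K z_n`. -/
structure Controller (τ : ℝ) (U₀ Y₀ Z : Type*)
    [NormedAddCommGroup U₀] [InnerProductSpace ℂ U₀]
    [NormedAddCommGroup Y₀] [InnerProductSpace ℂ Y₀]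
    [NormedAddCommGroup Z] [NormedSpace ℂ Z] where
  G₁ : Z →L[ℂ] Z
  G₂ : L2 τ Y₀ →L[ℂ] Z
  K : Z →L[ℂ] L2 τ U₀

section ClosedLoop

variable {τ : ℝ} {X U₀ Ud₀ Y₀ Z : Type*}
  [NormedAddCommGroup X] [NormedSpace ℂ X]
  [NormedAddCommGroup U₀] [InnerProductSpace ℂ U₀]
  [NormedAddCommGroup Ud₀] [InnerProductSpace ℂ Ud₀]
  [NormedAddCommGroup Y₀] [InnerProductSpace ℂ Y₀]
  [NormedAddCommGroup Z] [NormedSpace ℂ Z]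

/-- The operator `𝒫 u = C(·) ∫₀^τ G(·,s) B(s) u(s) ds + C(·) ∫₀^· U(·,s) B(s) u(s) ds + D(·) u`
from `L²(0, τ; U₀)` to `L²(0, τ; Y₀)`. -/
def PeriodicSystem.P [CompleteSpace X] (sys : PeriodicSystem τ X U₀ Ud₀ Y₀) :
    L2 τ U₀ →L[ℂ] L2 τ Y₀ :=
  mulOp τ sys.C sys.memLp_C ∘L sys.steadyStateOp ∘L mulOp τ sys.B sys.memLp_B +
    mulOp τ sys.D sys.memLp_D

/-- The operator `𝒫_d w = C(·) ∫₀^τ G(·,s) B_d(s) w(s) ds + C(·) ∫₀^· U(·,s) B_d(s) w(s) ds`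
from `L²(0, τ; U_{d0})` to `L²(0, τ; Y₀)`. -/
def PeriodicSystem.Pd [CompleteSpace X] (sys : PeriodicSystem τ X U₀ Ud₀ Y₀) :
    L2 τ Ud₀ →L[ℂ] L2 τ Y₀ :=
  mulOp τ sys.C sys.memLp_C ∘L sys.steadyStateOp ∘L mulOp τ sys.Bd sys.memLp_Bd

theorem PeriodicSystem.coeFn_P [CompleteSpace X] (sys : PeriodicSystem τ X U₀ Ud₀ Y₀)
    (u : L2 τ U₀) : sys.P u =ᵐ[periodMeasure τ] fun t =>
      sys.C t (∫ s in (0 : ℝ)..τ, sys.green t s (sys.B s (u s))) +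
      sys.C t (∫ s in (0 : ℝ)..t, sys.evol t s (sys.B s (u s))) + sys.D t (u t) := by
  have hB := coeFn_mulOp τ sys.B sys.memLp_B u
  filter_upwards [Lp.coeFn_add (mulOp τ sys.C sys.memLp_C (sys.steadyStateOp
    (mulOp τ sys.B sys.memLp_B u))) (mulOp τ sys.D sys.memLp_D u),
    coeFn_mulOp τ sys.C sys.memLp_C (sys.steadyStateOp (mulOp τ sys.B sys.memLp_B u)),
    sys.coeFn_steadyStateOp (mulOp τ sys.B sys.memLp_B u), coeFn_mulOp τ sys.D sys.memLp_D u,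
    ae_restrict_mem measurableSet_Ioc] with t h1 h2 h3 h4 ht
  rw [← map_add]
  refine h1.trans ?_
  rw [Pi.add_apply, h2, h3, h4, sys.steadyState_congr hB ht]
  rfl

theorem PeriodicSystem.coeFn_Pd [CompleteSpace X] (sys : PeriodicSystem τ X U₀ Ud₀ Y₀)
    (w : L2 τ Ud₀) : sys.Pd w =ᵐ[periodMeasure τ] fun t =>
      sys.C t (∫ s in (0 : ℝ)..τ, sys.green t s (sys.Bd s (w s))) +
      sys.C t (∫ s in (0 : ℝ)..t, sys.evol t s (sys.Bd s (w s))) := by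
  have hB := coeFn_mulOp τ sys.Bd sys.memLp_Bd w
  filter_upwards [coeFn_mulOp τ sys.C sys.memLp_C (sys.steadyStateOp
    (mulOp τ sys.Bd sys.memLp_Bd w)), sys.coeFn_steadyStateOp (mulOp τ sys.Bd sys.memLp_Bd w),
    ae_restrict_mem measurableSet_Ioc] with t h2 h3 ht
  rw [← map_add]
  refine h2.trans ?_
  rw [h3, sys.steadyState_congr hB ht]
  rfl

/-- A trajectory of the closed-loop system with reference `yref`, disturbance `wd`, and initial
states `x0`, `z0`: state `x`, output `y`, and control `u` on `[0, ∞)`, controller states `z n`, and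
regulation errors `e n = y(nτ + ·) - yref ∈ L²(0, τ; Y₀)`. -/
structure ClosedLoopTrajectory (sys : PeriodicSystem τ X U₀ Ud₀ Y₀) (ctrl : Controller τ U₀ Y₀ Z)
    (yref : PeriodicSignal τ Y₀) (wd : PeriodicSignal τ Ud₀) (x0 : X) (z0 : Z) where
  x : ℝ → X
  y : ℝ → Y₀
  u : ℝ → U₀
  z : ℕ → Z
  e : ℕ → L2 τ Y₀
  /-- The mild state. -/
  state_eq : ∀ t, 0 ≤ t → x t = sys.evol t 0 x0 +
    ∫ s in (0 : ℝ)..t, sys.evol t s (sys.B s (u s) + sys.Bd s (wd s))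
  output_eq : ∀ t, 0 ≤ t → y t = sys.C t (x t) + sys.D t (u t)
  control_eq : ∀ n : ℕ, (fun s => u (n * τ + s)) =ᵐ[periodMeasure τ] ctrl.K (z n)
  error_eq : ∀ n : ℕ, e n =ᵐ[periodMeasure τ] fun s => y (n * τ + s) - yref s
  z_zero : z 0 = z0
  z_succ : ∀ n, z (n + 1) = ctrl.G₁ (z n) + ctrl.G₂ (e n)

/-- For all signals and all initial states the closed-loop system has a trajectory. -/
def ClosedLoopWellPosed (sys : PeriodicSystem τ X U₀ Ud₀ Y₀) (ctrl : Controller τ U₀ Y₀ Z) : Prop :=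
  ∀ (yref : PeriodicSignal τ Y₀) (wd : PeriodicSignal τ Ud₀) (x0 : X) (z0 : Z),
    Nonempty (ClosedLoopTrajectory sys ctrl yref wd x0 z0)

/-- Exponential closed-loop stability (for `y_ref = 0` and `w_dist = 0`). -/
def ClosedLoopStable (sys : PeriodicSystem τ X U₀ Ud₀ Y₀) (ctrl : Controller τ U₀ Y₀ Z) : Prop :=
  ∃ M₀ > 0, ∃ M₁ > 0, ∃ α₀ > 0, ∃ α₁ > 0, ∀ (x0 : X) (z0 : Z)
    (T : ClosedLoopTrajectory sys ctrl 0 0 x0 z0),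
    (∀ t : ℝ, 0 ≤ t → ‖T.x t‖ ≤ M₀ * Real.exp (-α₀ * t) * (‖x0‖ + ‖z0‖)) ∧
    (∀ n : ℕ, ‖T.z n‖ ≤ M₁ * Real.exp (-α₁ * n) * (‖x0‖ + ‖z0‖))

/-- For all `τ`-periodic signals and all initial states the regulation error
`e n = y(nτ + ·) - y_ref` converges in `L²(0, τ; Y₀)` to `err y_ref w_dist`, at a uniform
exponential rate; in particular `‖e n‖ → ‖err y_ref w_dist‖`. -/
def ErrorConvergesTo (sys : PeriodicSystem τ X U₀ Ud₀ Y₀) (ctrl : Controller τ U₀ Y₀ Z)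
    (err : PeriodicSignal τ Y₀ → PeriodicSignal τ Ud₀ → L2 τ Y₀) : Prop :=
  ∃ M > 0, ∃ α > 0, ∀ (yref : PeriodicSignal τ Y₀) (wd : PeriodicSignal τ Ud₀) (x0 : X) (z0 : Z)
    (T : ClosedLoopTrajectory sys ctrl yref wd x0 z0) (n : ℕ),
    ‖T.e n - err yref wd‖ ≤
      M * Real.exp (-α * n) * (‖x0‖ + ‖z0‖ + ‖yref.toL2‖ + ‖wd.toL2‖)

/-- The asymptotic regulation error is `(I - Q) (𝒫 K z + 𝒫_d w_dist - y_ref)`, where `z` is the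
unique solution of `Q 𝒫 K z = Q y_ref - Q 𝒫_d w_dist`; here `Q` is a projection of `L²(0, τ; Y₀)`
onto the subspace `YN`. -/
def HasApproximateRegulationError [CompleteSpace X] (sys : PeriodicSystem τ X U₀ Ud₀ Y₀)
    (ctrl : Controller τ U₀ Y₀ Z) {YN : Submodule ℂ (L2 τ Y₀)} (Q : L2 τ Y₀ →L[ℂ] YN) : Prop :=
  ∃ zs : PeriodicSignal τ Y₀ → PeriodicSignal τ Ud₀ → Z,
    (∀ yref wd z, Q (sys.P (ctrl.K z)) = Q yref.toL2 - Q (sys.Pd wd.toL2) ↔ z = zs yref wd) ∧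
    ErrorConvergesTo sys ctrl fun yref wd =>
      (ContinuousLinearMap.id ℂ (L2 τ Y₀) - YN.subtypeL ∘L Q)
        (sys.P (ctrl.K (zs yref wd)) + sys.Pd wd.toL2 - yref.toL2)

end ClosedLoop

end

/-!
Sampling the closed loop at the instants `nτ` turns it into a time-invariant discrete-time system
`ξ ↦ 𝒜 ξ + ℛ d` on `X × Z`, where `d = (w_dist, y_ref)`. A uniform bound on the motion within one
period shows that the closed loop is exponentially stable if and only if `𝒜` is power stable. In
that case `1 - 𝒜` is invertible, so that the lifted state converges to the unique equilibrium, at a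
rate uniform in the data. As `G₁ = I`, the controller can only be at rest if the limiting error
lies in `ker G₂ = ker Q_N`: this is the internal model, and it needs nothing about the plant besides
closed-loop stability. If `1` is in the resolvent set of the monodromy operator, the plant component
of the equilibrium can be eliminated, which brings in `𝒫` and `𝒫_d`.

For the nominal system, `𝒜` is the block operator with entries `T = U(τ, 0)`, `ε b`, `W` and
`1 + ε d`. With `L = (1 - T)⁻¹ b`, subtracting from the plant state its quasi-steady state `ε L z`
makes the off-diagonal coupling into the plant of order `ε²`, while the controller block becomes
`1 + ε (W L + d) = 1 + ε G₂ 𝒫 K₀`. In seminorms adapted to the two diagonal blocks the former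
contracts at a fixed rate and the latter at the rate `1 - κ ε`, so that a small-gain argument
applies for all small `ε`.
-/

noncomputable section

section LpIntegrals

theorem integral_norm_coeFn_le_norm_Lp {α V : Type*} {m : MeasurableSpace α} {μ : Measure α}
    [IsFiniteMeasure μ] [NormedAddCommGroup V] {p : ℝ≥0∞} (hp : 1 ≤ p) (g : Lp V p μ) :
    ∫ s, ‖g s‖ ∂μ ≤ (μ univ ^ (1 - 1 / p.toReal)).toReal * ‖g‖ := by
  have hp' : 0 ≤ 1 - 1 / p.toReal := by
    rcases eq_or_ne p ∞ with rfl | hp_top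
    · simp
    · have : 1 ≤ p.toReal := by simpa using ENNReal.toReal_mono hp_top hp
      exact sub_nonneg.2 ((div_le_one (by positivity)).2 this)
  have h := eLpNorm_le_eLpNorm_mul_rpow_measure_univ hp (Lp.aestronglyMeasurable g)
  rw [eLpNorm_one_eq_lintegral_enorm, ENNReal.toReal_one, div_one] at h
  rw [integral_norm_eq_lintegral_enorm (Lp.aestronglyMeasurable g), Lp.norm_def, mul_comm,
    ← ENNReal.toReal_mul]
  exact ENNReal.toReal_mono (ENNReal.mul_ne_top (Lp.memLp g).2.ne
    (ENNReal.rpow_ne_top_of_nonneg hp' (measure_ne_top _ _))) h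

variable {τ : ℝ} {V : Type*} [NormedAddCommGroup V]

theorem integrable_coeFn_L2 (g : L2 τ V) : Integrable g (periodMeasure τ) :=
  (Lp.memLp g).integrable one_le_two

theorem integrable_of_forall_period (hτ : 0 ≤ τ) {f : ℝ → V}
    (hf : ∀ n : ℕ, Integrable (fun s => f (n * τ + s)) (periodMeasure τ)) (n : ℕ) :
    Integrable f (periodMeasure (n * τ)) := by
  have h : IntervalIntegrable f volume ((0 : ℕ) * τ) (n * τ) := by
    refine IntervalIntegrable.trans_iterate (a := fun k : ℕ => (k : ℝ) * τ) fun k _ => ?_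
    have hk : IntervalIntegrable (fun s => f (k * τ + s)) volume 0 τ :=
      (intervalIntegrable_iff_integrableOn_Ioc_of_le hτ).2 (hf k)
    have hk' := hk.comp_add_left (-(k * τ))
    simp only [add_neg_cancel_left] at hk'
    convert hk' using 1 <;> push_cast <;> ring
  have hn : (0 : ℕ) * τ ≤ n * τ := by gcongr; exact n.zero_le
  simpa [IntegrableOn] using (intervalIntegrable_iff_integrableOn_Ioc_of_le hn).1 h

end LpIntegrals

namespace PeriodicEvolutionFamily

variable {τ : ℝ} {X : Type*} [NormedAddCommGroup X] [NormedSpace ℂ X]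

theorem evol_nat_mul_add (E : PeriodicEvolutionFamily τ X) (n : ℕ) {t s : ℝ} (h : s ≤ t) :
    E.evol (n * τ + t) (n * τ + s) = E.evol t s := by
  induction n with
  | zero => simp
  | succ n ih =>
    rw [← ih, ← E.evol_periodic (n * τ + t) (n * τ + s) (by linarith)]
    push_cast
    ring_nf

theorem evol_nat_mul_add_nat_mul (E : PeriodicEvolutionFamily τ X) (n : ℕ) {t : ℝ} (h : 0 ≤ t) :
    E.evol (n * τ + t) (n * τ) = E.evol t 0 := by
  simpa using E.evol_nat_mul_add n h

theorem evol_nat_mul (E : PeriodicEvolutionFamily τ X) (n : ℕ) :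
    E.evol (n * τ) 0 = E.evol τ 0 ^ n := by
  have hτ := E.period_pos
  induction n with
  | zero => simp [E.evol_self, ContinuousLinearMap.one_def]
  | succ n ih =>
    rw [pow_succ', ← ih, ← E.evol_nat_mul_add_nat_mul n hτ.le, ContinuousLinearMap.mul_def,
      E.evol_comp _ _ _ (by positivity) (by linarith)]
    push_cast
    ring_nf

/-- The evolution family regarded as an `(n + 1)τ`-periodic one; this extends the estimates on one
period to `[0, (n + 1)τ]`. -/
def multiple (E : PeriodicEvolutionFamily τ X) (n : ℕ) :
    PeriodicEvolutionFamily ((n + 1 : ℕ) * τ) X where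
  period_pos := mul_pos (by positivity) E.period_pos
  evol := E.evol
  evol_self := E.evol_self
  evol_comp := E.evol_comp
  evol_cont := E.evol_cont
  evol_periodic t s h := by
    rw [add_comm t, add_comm s, E.evol_nat_mul_add _ h]

variable [CompleteSpace X]

theorem intervalIntegrable_evol_of_mem_Icc (E : PeriodicEvolutionFamily τ X) {g : ℝ → X}
    (hg : Integrable g (periodMeasure τ)) {t : ℝ} (ht : t ∈ Icc 0 τ) :
    IntervalIntegrable (fun s => E.evol t s (g s)) volume 0 t := by
  rcases ht.1.eq_or_lt with rfl | h0
  · exact IntervalIntegrable.refl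
  obtain ⟨M, hM⟩ := E.exists_bound
  have hsub : Ioc 0 t ⊆ Ioc 0 τ := Ioc_subset_Ioc_right ht.2
  have hmeas : AEStronglyMeasurable (fun s => E.evol t s (g s)) (volume.restrict (Ioc 0 t)) := by
    refine ((E.aestronglyMeasurable_evol hg.1 ⟨h0, ht.2⟩).mono_measure
      (Measure.restrict_mono hsub le_rfl)).congr ?_
    filter_upwards [ae_restrict_mem measurableSet_Ioc] with s hs
    exact if_pos hs.2
  rw [intervalIntegrable_iff_integrableOn_Ioc_of_le ht.1]
  refine ((hg.mono_measure (Measure.restrict_mono hsub le_rfl)).norm.const_mul M).mono' hmeas ?_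
  filter_upwards [ae_restrict_mem measurableSet_Ioc] with s hs
  exact ContinuousLinearMap.le_of_opNorm_le _ (hM _ _ hs.1.le hs.2 ht.2) _

theorem intervalIntegrable_evol (E : PeriodicEvolutionFamily τ X) {f : ℝ → X}
    (hf : ∀ n : ℕ, Integrable (fun s => f (n * τ + s)) (periodMeasure τ)) {t : ℝ} (ht : 0 ≤ t) :
    IntervalIntegrable (fun s => E.evol t s (f s)) volume 0 t := by
  have hn : t ≤ (⌈t / τ⌉₊ + 1 : ℕ) * τ := by
    rw [← div_le_iff₀ E.period_pos]
    push_cast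
    linarith [Nat.le_ceil (t / τ)]
  exact (E.multiple ⌈t / τ⌉₊).intervalIntegrable_evol_of_mem_Icc
    (integrable_of_forall_period E.period_pos.le hf _) ⟨ht, hn⟩

theorem integral_evol_nat_mul_add (E : PeriodicEvolutionFamily τ X) {f : ℝ → X}
    (hf : ∀ n : ℕ, Integrable (fun s => f (n * τ + s)) (periodMeasure τ))
    (n : ℕ) {t : ℝ} (ht : 0 ≤ t) :
    ∫ s in (0 : ℝ)..(n * τ + t), E.evol (n * τ + t) s (f s) =
      E.evol t 0 (∫ s in (0 : ℝ)..(n * τ), E.evol (n * τ) s (f s)) +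
        ∫ s in (0 : ℝ)..t, E.evol t s (f (n * τ + s)) := by
  have hn : 0 ≤ n * τ := mul_nonneg n.cast_nonneg E.period_pos.le
  have hnt : n * τ ≤ n * τ + t := le_add_of_nonneg_right ht
  have hint := E.intervalIntegrable_evol hf (hn.trans hnt)
  have hmem : n * τ ∈ uIcc 0 (n * τ + t) := by
    rw [uIcc_of_le (hn.trans hnt)]
    exact ⟨hn, hnt⟩
  rw [← intervalIntegral.integral_add_adjacent_intervals
    (hint.mono_set (uIcc_subset_uIcc_left hmem)) (hint.mono_set (uIcc_subset_uIcc_right hmem))]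
  congr 1
  · rw [← ContinuousLinearMap.intervalIntegral_comp_comm _ (E.intervalIntegrable_evol hf hn)]
    refine intervalIntegral.integral_congr fun s hs => ?_
    rw [uIcc_of_le hn] at hs
    simp only [← E.evol_comp _ _ _ hs.2 hnt, E.evol_nat_mul_add_nat_mul n ht,
      ContinuousLinearMap.comp_apply]
  · have hshift := intervalIntegral.integral_comp_add_left (a := 0) (b := t)
      (fun s => E.evol (n * τ + t) s (f s)) (n * τ)
    rw [add_zero] at hshift
    rw [← hshift]
    refine intervalIntegral.integral_congr fun s hs => ?_
    rw [uIcc_of_le ht] at hs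
    simp only [E.evol_nat_mul_add n hs.2]

theorem mild_nat_mul_add (E : PeriodicEvolutionFamily τ X) {f x : ℝ → X} {x₀ : X}
    (hf : ∀ n : ℕ, Integrable (fun s => f (n * τ + s)) (periodMeasure τ))
    (hx : ∀ t, 0 ≤ t → x t = E.evol t 0 x₀ + ∫ s in (0 : ℝ)..t, E.evol t s (f s))
    (n : ℕ) {t : ℝ} (ht : 0 ≤ t) :
    x (n * τ + t) = E.evol t 0 (x (n * τ)) +
      ∫ s in (0 : ℝ)..t, E.evol t s (f (n * τ + s)) := by
  have hn : 0 ≤ n * τ := mul_nonneg n.cast_nonneg E.period_pos.le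
  have hnt : n * τ ≤ n * τ + t := le_add_of_nonneg_right ht
  rw [hx _ (hn.trans hnt), hx _ hn, E.integral_evol_nat_mul_add hf n ht, map_add, add_assoc,
    ← E.evol_comp _ _ _ hn hnt, E.evol_nat_mul_add_nat_mul n ht, ContinuousLinearMap.comp_apply]

theorem exists_norm_integral_evol_le (E : PeriodicEvolutionFamily τ X) :
    ∃ c : ℝ, 0 ≤ c ∧ ∀ g : L2 τ X, ∀ t ∈ Icc 0 τ,
      ‖∫ s in (0 : ℝ)..t, E.evol t s (g s)‖ ≤ c * ‖g‖ := by
  obtain ⟨M, hM⟩ := E.exists_bound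
  refine ⟨M * ((periodMeasure τ) univ ^ (1 - 1 / (2 : ℝ≥0∞).toReal)).toReal, by positivity,
    fun g t ht => ?_⟩
  have hg := integrable_coeFn_L2 g
  have hsub : Ioc 0 t ⊆ Ioc 0 τ := Ioc_subset_Ioc_right ht.2
  have hgt : IntegrableOn (fun s => ‖g s‖) (Ioc 0 t) := IntegrableOn.mono_set hg.norm hsub
  calc ‖∫ s in (0 : ℝ)..t, E.evol t s (g s)‖
      ≤ ∫ s in Ioc 0 t, M * ‖g s‖ := by
        rw [intervalIntegral.integral_of_le ht.1]
        refine norm_integral_le_of_norm_le (hgt.const_mul _) ?_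
        filter_upwards [ae_restrict_mem measurableSet_Ioc] with s hs
        exact ContinuousLinearMap.le_of_opNorm_le _ (hM _ _ hs.1.le hs.2 ht.2) _
    _ ≤ ∫ s in Ioc 0 τ, M * ‖g s‖ :=
        setIntegral_mono_set (hg.norm.const_mul _) (ae_of_all _ fun s => by positivity)
          hsub.eventuallyLE
    _ ≤ M * _ * ‖g‖ := by
        rw [integral_const_mul, mul_assoc]
        exact mul_le_mul_of_nonneg_left (integral_norm_coeFn_le_norm_Lp one_le_two g) M.2

/-- The state `∫₀^τ U(τ,s) g(s) ds` reached at the end of a period from the zero state. -/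
def terminalOp (E : PeriodicEvolutionFamily τ X) : L2 τ X →L[ℂ] X :=
  LinearMap.mkContinuousOfExistsBound
    { toFun := fun g => ∫ s in (0 : ℝ)..τ, E.evol τ s (g s)
      map_add' := fun f g => by
        have hτ : τ ∈ Icc 0 τ := ⟨E.period_pos.le, le_rfl⟩
        rw [← intervalIntegral.integral_add
          (E.intervalIntegrable_evol_of_mem_Icc (integrable_coeFn_L2 f) hτ)
          (E.intervalIntegrable_evol_of_mem_Icc (integrable_coeFn_L2 g) hτ),
          intervalIntegral.integral_of_le hτ.1, intervalIntegral.integral_of_le hτ.1]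
        refine integral_congr_ae ?_
        filter_upwards [Lp.coeFn_add f g] with s hs
        rw [hs, Pi.add_apply, map_add]
      map_smul' := fun a g => by
        rw [RingHom.id_apply, ← intervalIntegral.integral_smul,
          intervalIntegral.integral_of_le E.period_pos.le,
          intervalIntegral.integral_of_le E.period_pos.le]
        refine integral_congr_ae ?_
        filter_upwards [Lp.coeFn_smul a g] with s hs
        rw [hs, Pi.smul_apply, map_smul] }
    (E.exists_norm_integral_evol_le.imp fun _ hc g => hc.2 g τ ⟨E.period_pos.le, le_rfl⟩)

theorem terminalOp_apply (E : PeriodicEvolutionFamily τ X) (g : L2 τ X) :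
    E.terminalOp g = ∫ s in (0 : ℝ)..τ, E.evol τ s (g s) :=
  rfl

theorem memLp_evol_zero (E : PeriodicEvolutionFamily τ X) (x : X) :
    MemLp (fun t => E.evol t 0 x) 2 (periodMeasure τ) := by
  obtain ⟨M, hM⟩ := E.exists_bound
  have hcont : ContinuousOn (fun t => E.evol t 0 x) (Ioc 0 τ) :=
    (E.evol_cont x).comp (by fun_prop : ContinuousOn (fun t : ℝ => (t, (0 : ℝ))) (Ioc 0 τ))
      fun t ht => ht.1.le
  refine MemLp.of_bound (hcont.aestronglyMeasurable measurableSet_Ioc) (M * ‖x‖) ?_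
  filter_upwards [ae_restrict_mem measurableSet_Ioc] with t ht
  exact ContinuousLinearMap.le_of_opNorm_le _ (hM _ _ le_rfl ht.1.le ht.2) _

/-- The free motion `x ↦ U(·,0) x` on one period. -/
def freeOp (E : PeriodicEvolutionFamily τ X) : X →L[ℂ] L2 τ X :=
  LinearMap.mkContinuousOfExistsBound
    { toFun := fun x => (E.memLp_evol_zero x).toLp _
      map_add' := fun x y => by
        rw [← MemLp.toLp_add]
        exact MemLp.toLp_congr _ _ (ae_of_all _ fun t => map_add _ x y)
      map_smul' := fun a x => by
        rw [RingHom.id_apply, ← MemLp.toLp_const_smul]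
        exact MemLp.toLp_congr _ _ (ae_of_all _ fun t => map_smul _ a x) }
    (by
      obtain ⟨M, hM⟩ := E.exists_bound
      refine ⟨measureUnivNNReal (periodMeasure τ) ^ ((2 : ℝ≥0∞).toReal)⁻¹ * M, fun x => ?_⟩
      rw [mul_assoc]
      refine Lp.norm_le_of_ae_bound (f := (E.memLp_evol_zero x).toLp _) (by positivity) ?_
      filter_upwards [(E.memLp_evol_zero x).coeFn_toLp, ae_restrict_mem measurableSet_Ioc]
        with t hx ht
      rw [hx]
      exact ContinuousLinearMap.le_of_opNorm_le _ (hM _ _ le_rfl ht.1.le ht.2) _)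

theorem coeFn_freeOp (E : PeriodicEvolutionFamily τ X) (x : X) :
    E.freeOp x =ᵐ[periodMeasure τ] fun t => E.evol t 0 x :=
  (E.memLp_evol_zero x).coeFn_toLp

/-- The forced motion `g ↦ ∫₀ᵗ U(t,s) g(s) ds` on one period, obtained from the already bounded
`steadyStateOp` by removing the contribution of the Green kernel. -/
def forcedOp (E : PeriodicEvolutionFamily τ X) : L2 τ X →L[ℂ] L2 τ X :=
  E.steadyStateOp - E.freeOp ∘L E.monodromyResolvent ∘L E.terminalOp

theorem steadyStateOp_eq (E : PeriodicEvolutionFamily τ X) :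
    E.steadyStateOp = E.freeOp ∘L E.monodromyResolvent ∘L E.terminalOp + E.forcedOp :=
  (add_sub_cancel _ _).symm

theorem coeFn_forcedOp (E : PeriodicEvolutionFamily τ X) (g : L2 τ X) :
    E.forcedOp g =ᵐ[periodMeasure τ] fun t => ∫ s in (0 : ℝ)..t, E.evol t s (g s) := by
  filter_upwards [Lp.coeFn_sub (E.steadyStateOp g)
      (E.freeOp (E.monodromyResolvent (E.terminalOp g))), E.coeFn_steadyStateOp g,
    E.coeFn_freeOp (E.monodromyResolvent (E.terminalOp g))] with t hsub hsteady hfree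
  have hgreen : ∫ s in (0 : ℝ)..τ, E.green t s (g s) =
      E.evol t 0 (E.monodromyResolvent (E.terminalOp g)) :=
    (E.evol t 0 ∘L E.monodromyResolvent).intervalIntegral_comp_comm
      (E.intervalIntegrable_evol_of_mem_Icc (integrable_coeFn_L2 g) ⟨E.period_pos.le, le_rfl⟩)
  refine hsub.trans ?_
  rw [Pi.sub_apply, hsteady, hfree, steadyState, hgreen, add_sub_cancel_left]

end PeriodicEvolutionFamily

section PowerStable

/-- Power stability of an element of a normed ring, the discrete-time notion of exponential
stability. -/
def PowerStable {R : Type*} [NormedRing R] (a : R) : Prop :=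
  ∃ M > 0, ∃ ρ ∈ Ioo (0 : ℝ) 1, ∀ n : ℕ, ‖a ^ n‖ ≤ M * ρ ^ n

variable {R : Type*} [NormedRing R] {a b : R}

theorem powerStable_iff_exp :
    PowerStable a ↔ ∃ M > 0, ∃ α > 0, ∀ n : ℕ, ‖a ^ n‖ ≤ M * Real.exp (-α * n) := by
  have hexp (α : ℝ) (n : ℕ) : Real.exp (-α * n) = Real.exp (-α) ^ n := by
    rw [← Real.exp_nat_mul, mul_comm]
  constructor
  · rintro ⟨M, hM, ρ, hρ, h⟩
    refine ⟨M, hM, -Real.log ρ, neg_pos.2 (Real.log_neg hρ.1 hρ.2), fun n => ?_⟩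
    rw [hexp, neg_neg, Real.exp_log hρ.1]
    exact h n
  · rintro ⟨M, hM, α, hα, h⟩
    exact ⟨M, hM, Real.exp (-α), ⟨Real.exp_pos _, Real.exp_lt_one_iff.2 (neg_neg_of_pos hα)⟩,
      fun n => hexp α n ▸ h n⟩

theorem PowerStable.isUnit_one_sub [CompleteSpace R] (ha : PowerStable a) : IsUnit (1 - a) := by
  obtain ⟨M, -, ρ, hρ, h⟩ := ha
  have hsum : Summable (a ^ ·) :=
    ((summable_geometric_of_lt_one hρ.1.le hρ.2).mul_left M).of_norm_bounded h
  exact ⟨⟨1 - a, ∑' n, a ^ n, hsum.one_sub_mul_tsum_pow, hsum.tsum_pow_mul_one_sub⟩, rfl⟩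

theorem PowerStable.of_semiconjBy (hb : PowerStable b) {s t : R} (hts : t * s = 1)
    (hs : SemiconjBy s a b) : PowerStable a := by
  obtain ⟨M, hM, ρ, hρ, h⟩ := hb
  refine ⟨(‖t‖ + 1) * M * (‖s‖ + 1), by positivity, ρ, hρ, fun n => ?_⟩
  have hρn : 0 ≤ ρ ^ n := pow_nonneg hρ.1.le n
  calc ‖a ^ n‖ = ‖t * b ^ n * s‖ := by
        rw [mul_assoc, ← (hs.pow_right n).eq, ← mul_assoc, hts, one_mul]
    _ ≤ ‖t‖ * ‖b ^ n‖ * ‖s‖ := norm_mul₃_le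
    _ ≤ (‖t‖ + 1) * (M * ρ ^ n) * (‖s‖ + 1) := by
        gcongr
        · exact le_add_of_nonneg_right zero_le_one
        · exact h n
        · exact le_add_of_nonneg_right zero_le_one
    _ = (‖t‖ + 1) * M * (‖s‖ + 1) * ρ ^ n := by ring

theorem powerStable_of_spectralRadius_lt_one [NormedAlgebra ℂ R] [CompleteSpace R]
    (ha : spectralRadius ℂ a < 1) : PowerStable a := by
  obtain ⟨ρ, haρ, hρ⟩ := ENNReal.lt_iff_exists_nnreal_btwn.1 ha
  have hρ0 : 0 < ρ := by exact_mod_cast zero_le.trans_lt haρ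
  have hgelfand : ∀ᶠ n : ℕ in atTop, ‖a ^ n‖ ≤ (ρ : ℝ) ^ n := by
    filter_upwards [(spectrum.pow_nnnorm_pow_one_div_tendsto_nhds_spectralRadius
      a).eventually_lt_const haρ, eventually_gt_atTop 0] with n hn hn0
    have hn' := ENNReal.rpow_le_rpow hn.le (z := n) n.cast_nonneg
    rw [← ENNReal.rpow_mul, one_div_mul_cancel (by exact_mod_cast hn0.ne'), ENNReal.rpow_one,
      ENNReal.rpow_natCast] at hn'
    exact_mod_cast hn'
  obtain ⟨M, hM, h⟩ := Asymptotics.bound_of_isBigO_nat_atTop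
    (Asymptotics.IsBigO.of_bound' (f := (a ^ ·)) (g := fun n => (ρ : ℝ) ^ n)
      (hgelfand.mono fun n hn => hn.trans (Real.le_norm_self _)))
  refine ⟨M, hM, ρ, ⟨by exact_mod_cast hρ0, by exact_mod_cast hρ⟩, fun n => ?_⟩
  have hn := h (x := n) (by positivity)
  rwa [Real.norm_of_nonneg (by positivity)] at hn

theorem norm_one_add_lt_one_iff_norm_sq_lt {z : ℂ} : ‖1 + z‖ < 1 ↔ ‖z‖ ^ 2 < -2 * z.re := by
  rw [← sq_lt_one_iff₀ (norm_nonneg _), Complex.sq_norm, Complex.sq_norm, Complex.normSq_add,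
    Complex.normSq_one]
  simp only [one_mul, Complex.conj_re]
  constructor <;> intro h <;> linarith

theorem exists_norm_one_add_mul_lt_one {K : Set ℂ} (hK : IsCompact K)
    (hre : ∀ μ ∈ K, μ.re < 0) : ∃ ε : ℝ, 0 < ε ∧ ∀ μ ∈ K, ‖1 + ε * μ‖ < 1 := by
  rcases K.eq_empty_or_nonempty with rfl | hne
  · exact ⟨1, one_pos, by simp⟩
  have hpos : ∀ μ ∈ K, 0 < ‖μ‖ ^ 2 := fun μ hμ => by
    have : μ ≠ 0 := by rintro rfl; exact (hre 0 hμ).ne rfl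
    positivity
  have hcont : ContinuousOn (fun μ : ℂ => -μ.re / ‖μ‖ ^ 2) K :=
    ContinuousOn.div (by fun_prop) (by fun_prop) fun μ hμ => (hpos μ hμ).ne'
  obtain ⟨μ₀, hμ₀, hmin⟩ := hK.exists_isMinOn hne hcont
  set ε := -μ₀.re / ‖μ₀‖ ^ 2
  have hε : 0 < ε := div_pos (neg_pos.2 (hre μ₀ hμ₀)) (hpos μ₀ hμ₀)
  refine ⟨ε, hε, fun μ hμ => norm_one_add_lt_one_iff_norm_sq_lt.2 ?_⟩
  have hle : ε * ‖μ‖ ^ 2 ≤ -μ.re := (le_div_iff₀ (hpos μ hμ)).1 (hmin hμ)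
  rw [norm_mul, mul_pow, Complex.norm_real, Real.norm_of_nonneg hε.le, Complex.re_ofReal_mul]
  nlinarith [mul_le_mul_of_nonneg_left hle hε.le, mul_neg_of_pos_of_neg hε (hre μ hμ)]

theorem exists_powerStable_one_add_smul [NormedAlgebra ℂ R] [CompleteSpace R] {s : R}
    (hs : ∀ μ ∈ spectrum ℂ s, μ.re < 0) : ∃ ε : ℝ, 0 < ε ∧ PowerStable (1 + (ε : ℂ) • s) := by
  rcases subsingleton_or_nontrivial R with _ | _
  · exact ⟨1, one_pos, powerStable_of_spectralRadius_lt_one (by simp)⟩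
  obtain ⟨ε, hε, hlt⟩ := exists_norm_one_add_mul_lt_one (spectrum.isCompact s) hs
  have hlt' : ∀ z ∈ spectrum ℂ (1 + (ε : ℂ) • s), ‖z‖₊ < 1 := fun z hz => by
    rw [← map_one (algebraMap ℂ R), ← spectrum.singleton_add_eq,
      spectrum.smul_eq_smul _ _ (spectrum.nonempty s)] at hz
    obtain ⟨_, rfl, _, ⟨μ, hμ, rfl⟩, rfl⟩ := hz
    exact_mod_cast hlt μ hμ
  exact ⟨ε, hε, powerStable_of_spectralRadius_lt_one
    (by exact_mod_cast spectrum.spectralRadius_lt_of_forall_lt _ hlt')⟩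

end PowerStable

section AffineIteration

variable {𝕜 V : Type*} [NontriviallyNormedField 𝕜] [NormedAddCommGroup V] [NormedSpace 𝕜 V]
  {A : V →L[𝕜] V}

theorem eq_map_add_iff_eq_inverse_one_sub (hA : IsUnit (1 - A)) {v f : V} :
    v = A v + f ↔ v = Ring.inverse (1 - A) f := by
  constructor <;> intro h
  · have hf : f = (1 - A) v := eq_sub_of_add_eq' h.symm
    rw [hf, ← mul_apply_eq_comp, Ring.inverse_mul_cancel _ hA, one_apply_eq_self]
  · have hf : (1 - A) v = f := by
      rw [h, ← mul_apply_eq_comp, Ring.mul_inverse_cancel _ hA, one_apply_eq_self]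
    rw [← hf]
    simp

theorem affine_iterate_sub_fixedPoint {f v' : V} {v : ℕ → V}
    (hv : ∀ n, v (n + 1) = A (v n) + f) (hv' : v' = A v' + f) (n : ℕ) :
    v n - v' = (A ^ n) (v 0 - v') := by
  induction n with
  | zero => simp
  | succ n ih =>
    rw [pow_succ', mul_apply_eq_comp, ← ih, map_sub, hv]
    nth_rewrite 1 [hv']
    abel

end AffineIteration

section AdaptedSeminorm

/-- The seminorm `p` is equivalent to the norm, normalised so that `‖v‖ ≤ p v ≤ C ‖v‖`. -/
structure IsEquivSeminorm {𝕜 V : Type*} [NormedField 𝕜] [NormedAddCommGroup V] [NormedSpace 𝕜 V]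
    (p : Seminorm 𝕜 V) (C : NNReal) : Prop where
  norm_le : ∀ v, ‖v‖ ≤ p v
  le_norm : ∀ v, p v ≤ C * ‖v‖

section NontriviallyNormedField

variable {𝕜 V W : Type*} [NontriviallyNormedField 𝕜] [NormedAddCommGroup V] [NormedSpace 𝕜 V]
  [NormedAddCommGroup W] [NormedSpace 𝕜 W]

theorem IsEquivSeminorm.map_le {p : Seminorm 𝕜 V} {σ : Seminorm 𝕜 W} {C D : NNReal}
    (hp : IsEquivSeminorm p C) (hσ : IsEquivSeminorm σ D) (A : V →L[𝕜] W) (v : V) :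
    σ (A v) ≤ D * ‖A‖ * p v := by
  calc σ (A v) ≤ D * ‖A v‖ := hσ.le_norm _
    _ ≤ D * (‖A‖ * p v) := by gcongr; exact A.le_opNorm_of_le (hp.norm_le v)
    _ = D * ‖A‖ * p v := (mul_assoc _ _ _).symm

theorem exists_isEquivSeminorm_map_le_of_norm_pow_le {A : V →L[𝕜] V} {M : NNReal}
    (hA : ∀ n : ℕ, ‖A ^ n‖ ≤ M) :
    ∃ p : Seminorm 𝕜 V, IsEquivSeminorm p M ∧ ∀ v, p (A v) ≤ p v := by
  let q (n : ℕ) : Seminorm 𝕜 V := (normSeminorm 𝕜 V).comp (A ^ n : V →L[𝕜] V).toLinearMap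
  have hq (n : ℕ) (v : V) : q n v = ‖(A ^ n) v‖ := rfl
  have hle (n : ℕ) (v : V) : q n v ≤ M * ‖v‖ := (A ^ n).le_of_opNorm_le (hA n) v
  have hbdd (v : V) : BddAbove (range fun n => q n v) :=
    ⟨M * ‖v‖, forall_mem_range.2 fun n => hle n v⟩
  have hsup (v : V) : (⨆ n, q n) v = ⨆ n, q n v :=
    Seminorm.iSup_apply (Seminorm.bddAbove_range_iff.2 hbdd)
  refine ⟨⨆ n, q n, ⟨fun v => ?_, fun v => ?_⟩, fun v => ?_⟩
  · rw [hsup]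
    simpa [hq] using le_ciSup (hbdd v) 0
  · rw [hsup]
    exact ciSup_le fun n => hle n v
  · rw [hsup, hsup]
    refine ciSup_le fun n => ?_
    rw [hq, ← mul_apply_eq_comp, ← pow_succ]
    exact le_ciSup (hbdd v) (n + 1)

theorem powerStable_of_map_le {A : V →L[𝕜] V} {p : V → ℝ} {c C q : ℝ} (hC : 0 < C) (hq : q < 1)
    (hnorm_le : ∀ v, ‖v‖ ≤ C * p v) (hle_norm : ∀ v, p v ≤ c * ‖v‖)
    (hA : ∀ v, p (A v) ≤ q * p v) : PowerStable A := by
  have hp (v : V) : 0 ≤ p v :=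
    (mul_nonneg_iff_of_pos_left hC).1 ((norm_nonneg v).trans (hnorm_le v))
  set ρ := max q (1 / 2)
  have hρ : 0 < ρ := lt_max_of_lt_right one_half_pos
  have hpow (n : ℕ) (v : V) : p ((A ^ n) v) ≤ ρ ^ n * p v := by
    induction n with
    | zero => simp
    | succ n ih =>
      rw [pow_succ', mul_apply_eq_comp, pow_succ', mul_assoc]
      calc p (A ((A ^ n) v)) ≤ q * p ((A ^ n) v) := hA _
        _ ≤ ρ * p ((A ^ n) v) := mul_le_mul_of_nonneg_right (le_max_left _ _) (hp _)
        _ ≤ ρ * (ρ ^ n * p v) := mul_le_mul_of_nonneg_left ih hρ.le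
  refine ⟨C * max c 1, by positivity, ρ, ⟨hρ, max_lt hq one_half_lt_one⟩, fun n =>
    ContinuousLinearMap.opNorm_le_bound _ (by positivity) fun v => ?_⟩
  calc ‖(A ^ n) v‖ ≤ C * (ρ ^ n * p v) :=
        (hnorm_le _).trans (mul_le_mul_of_nonneg_left (hpow n v) hC.le)
    _ ≤ C * (ρ ^ n * (max c 1 * ‖v‖)) := by
        gcongr
        exact (hle_norm v).trans (mul_le_mul_of_nonneg_right (le_max_left _ _) (norm_nonneg v))
    _ = C * max c 1 * ρ ^ n * ‖v‖ := by ring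

end NontriviallyNormedField

section RCLike

variable {𝕜 V : Type*} [RCLike 𝕜] [NormedAddCommGroup V] [NormedSpace 𝕜 V] {A : V →L[𝕜] V}

theorem PowerStable.exists_isEquivSeminorm (hA : PowerStable A) :
    ∃ (p : Seminorm 𝕜 V) (C : NNReal) (q : ℝ), IsEquivSeminorm p C ∧ q < 1 ∧
      ∀ v, p (A v) ≤ q * p v := by
  obtain ⟨M, hM, ρ, hρ, h⟩ := hA
  lift M to NNReal using hM.le
  obtain ⟨p, hp, hle⟩ :=
    exists_isEquivSeminorm_map_le_of_norm_pow_le (A := (ρ⁻¹ : 𝕜) • A) (M := M) fun n => by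
      rw [smul_pow, norm_smul, norm_pow, norm_inv, RCLike.norm_ofReal, abs_of_pos hρ.1, inv_pow,
        inv_mul_le_iff₀ (pow_pos hρ.1 n), mul_comm]
      exact h n
  refine ⟨p, M, ρ, hp, hρ.2, fun v => ?_⟩
  have hv := hle v
  rwa [smul_apply, map_smul_eq_mul, norm_inv, RCLike.norm_ofReal, abs_of_pos hρ.1,
    inv_mul_le_iff₀ hρ.1] at hv

-- For `0 < ε ≤ ε₀` the operator `1 + ε S` is a convex combination of `1` and `1 + ε₀ S`.
theorem map_add_smul_le_of_le {p : Seminorm 𝕜 V} {ε₀ q : ℝ}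
    (h₀ : ∀ v, p (v + (ε₀ : 𝕜) • A v) ≤ q * p v) {ε : ℝ} (hε : 0 < ε) (hle : ε ≤ ε₀) (v : V) :
    p (v + (ε : 𝕜) • A v) ≤ (1 - (1 - q) / ε₀ * ε) * p v := by
  have hε₀ : 0 < ε₀ := hε.trans_le hle
  set r := ε / ε₀
  have hr0 : 0 ≤ r := by positivity
  have hr1 : r ≤ 1 := (div_le_one hε₀).2 hle
  have hε_eq : ε = r * ε₀ := (div_mul_cancel₀ _ hε₀.ne').symm
  have hconv : v + (ε : 𝕜) • A v = ((1 - r : ℝ) : 𝕜) • v + (r : 𝕜) • (v + (ε₀ : 𝕜) • A v) := by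
    rw [hε_eq]
    push_cast
    module
  calc p (v + (ε : 𝕜) • A v) ≤ (1 - r) * p v + r * p (v + (ε₀ : 𝕜) • A v) := by
        rw [hconv]
        refine (map_add_le_add p _ _).trans_eq ?_
        rw [map_smul_eq_mul, map_smul_eq_mul, RCLike.norm_ofReal, RCLike.norm_ofReal,
          abs_of_nonneg (sub_nonneg.2 hr1), abs_of_nonneg hr0]
    _ ≤ (1 - r) * p v + r * (q * p v) := by gcongr; exact h₀ v
    _ = (1 - (1 - q) / ε₀ * ε) * p v := by ring

end RCLike

theorem exists_isEquivSeminorm_add_smul_le {V : Type*} [NormedAddCommGroup V] [NormedSpace ℂ V]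
    [CompleteSpace V] {S : V →L[ℂ] V} (hS : ∀ μ ∈ spectrum ℂ S, μ.re < 0) :
    ∃ (p : Seminorm ℂ V) (C : NNReal) (κ : ℝ), IsEquivSeminorm p C ∧ 0 < κ ∧
      ∀ᶠ ε : ℝ in 𝓝[>] 0, ∀ v, p (v + (ε : ℂ) • S v) ≤ (1 - κ * ε) * p v := by
  obtain ⟨ε₀, hε₀, hstable⟩ := exists_powerStable_one_add_smul hS
  obtain ⟨p, C, q, hp, hq, hle⟩ := hstable.exists_isEquivSeminorm
  refine ⟨p, C, (1 - q) / ε₀, hp, div_pos (sub_pos.2 hq) hε₀, ?_⟩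
  filter_upwards [Ioc_mem_nhdsGT hε₀] with ε hε
  exact map_add_smul_le_of_le hle hε.1 hε.2

end AdaptedSeminorm

section BlockOperator

theorem norm_prod_le_add {V W : Type*} [SeminormedAddCommGroup V] [SeminormedAddCommGroup W]
    (v : V × W) : ‖v‖ ≤ ‖v.1‖ + ‖v.2‖ :=
  max_le_add_of_nonneg (norm_nonneg _) (norm_nonneg _)

/-- The block operator `(v₁, v₂) ↦ (a v₁ + b v₂, c v₁ + d v₂)`. -/
def blockOp {𝕜 V₁ V₂ W₁ W₂ : Type*} [NontriviallyNormedField 𝕜]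
    [NormedAddCommGroup V₁] [NormedSpace 𝕜 V₁] [NormedAddCommGroup V₂] [NormedSpace 𝕜 V₂]
    [NormedAddCommGroup W₁] [NormedSpace 𝕜 W₁] [NormedAddCommGroup W₂] [NormedSpace 𝕜 W₂]
    (a : V₁ →L[𝕜] W₁) (b : V₂ →L[𝕜] W₁) (c : V₁ →L[𝕜] W₂) (d : V₂ →L[𝕜] W₂) :
    V₁ × V₂ →L[𝕜] W₁ × W₂ :=
  (a.coprod b).prod (c.coprod d)

@[simp]
theorem blockOp_apply {𝕜 V₁ V₂ W₁ W₂ : Type*} [NontriviallyNormedField 𝕜]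
    [NormedAddCommGroup V₁] [NormedSpace 𝕜 V₁] [NormedAddCommGroup V₂] [NormedSpace 𝕜 V₂]
    [NormedAddCommGroup W₁] [NormedSpace 𝕜 W₁] [NormedAddCommGroup W₂] [NormedSpace 𝕜 W₂]
    (a : V₁ →L[𝕜] W₁) (b : V₂ →L[𝕜] W₁) (c : V₁ →L[𝕜] W₂) (d : V₂ →L[𝕜] W₂) (v : V₁ × V₂) :
    blockOp a b c d v = (a v.1 + b v.2, c v.1 + d v.2) :=
  rfl

section NontriviallyNormedField

variable {𝕜 X Z : Type*} [NontriviallyNormedField 𝕜] [NormedAddCommGroup X] [NormedSpace 𝕜 X]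
  [NormedAddCommGroup Z] [NormedSpace 𝕜 Z]

theorem exists_pos_mul_add_lt {α β γ δ : ℝ} (hα : α < 1) (hβ : 0 ≤ β) (hγ : 0 ≤ γ)
    (hgain : β * γ < (1 - α) * (1 - δ)) : ∃ a > 0, a * α + γ < a ∧ a * β + δ < 1 := by
  have hα' : 0 < 1 - α := sub_pos.2 hα
  set t := ((1 - α) * (1 - δ) - β * γ) / (β + 1)
  have ht : 0 < t := div_pos (sub_pos.2 hgain) (by positivity)
  have htβ : t * (β + 1) = (1 - α) * (1 - δ) - β * γ := div_mul_cancel₀ _ (by positivity)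
  have ha : (γ + t) / (1 - α) * (1 - α) = γ + t := div_mul_cancel₀ _ hα'.ne'
  refine ⟨(γ + t) / (1 - α), by positivity, by linarith, ?_⟩
  rw [← lt_sub_iff_add_lt, div_mul_eq_mul_div, div_lt_iff₀ hα']
  linarith

theorem powerStable_blockOp_of_small_gain {T : X →L[𝕜] X} {b : Z →L[𝕜] X} {W : X →L[𝕜] Z}
    {d : Z →L[𝕜] Z} {p : Seminorm 𝕜 X} {σ : Seminorm 𝕜 Z} {C D : NNReal}
    (hp : IsEquivSeminorm p C) (hσ : IsEquivSeminorm σ D) {α β γ δ : ℝ} (hα : α < 1) (hβ : 0 ≤ β)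
    (hγ : 0 ≤ γ) (hgain : β * γ < (1 - α) * (1 - δ)) (hT : ∀ x, p (T x) ≤ α * p x)
    (hb : ∀ z, p (b z) ≤ β * σ z) (hW : ∀ x, σ (W x) ≤ γ * p x) (hd : ∀ z, σ (d z) ≤ δ * σ z) :
    PowerStable (blockOp T b W d) := by
  obtain ⟨a, ha, haα, haβ⟩ := exists_pos_mul_add_lt hα hβ hγ hgain
  set q := max ((a * α + γ) / a) (a * β + δ)
  have hq : q < 1 := max_lt ((div_lt_one ha).2 haα) haβ
  have hqa : a * α + γ ≤ q * a := (div_le_iff₀ ha).1 (le_max_left _ _)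
  refine powerStable_of_map_le (p := fun v => a * p v.1 + σ v.2) (C := max a⁻¹ 1)
    (c := a * C + D) (by positivity) hq (fun v => ?_) (fun v => ?_) fun v => ?_
  · have hpv : p v.1 ≤ max a⁻¹ 1 * (a * p v.1) := by
      calc p v.1 = a⁻¹ * (a * p v.1) := (inv_mul_cancel_left₀ ha.ne' _).symm
        _ ≤ _ := by gcongr; exact le_max_left _ _
    have hσv : σ v.2 ≤ max a⁻¹ 1 * σ v.2 :=
      le_mul_of_one_le_left (apply_nonneg σ _) (le_max_right _ _)
    rw [mul_add]
    exact (norm_prod_le_add v).trans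
      (add_le_add ((hp.norm_le _).trans hpv) ((hσ.norm_le _).trans hσv))
  · rw [add_mul, mul_assoc]
    gcongr
    · exact (hp.le_norm _).trans (by gcongr; exact norm_fst_le v)
    · exact (hσ.le_norm _).trans (by gcongr; exact norm_snd_le v)
  · calc a * p (T v.1 + b v.2) + σ (W v.1 + d v.2)
        ≤ a * (α * p v.1 + β * σ v.2) + (γ * p v.1 + δ * σ v.2) := by
          gcongr
          · exact (map_add_le_add p _ _).trans (add_le_add (hT _) (hb _))
          · exact (map_add_le_add σ _ _).trans (add_le_add (hW _) (hd _))
      _ = (a * α + γ) * p v.1 + (a * β + δ) * σ v.2 := by ring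
      _ ≤ q * a * p v.1 + q * σ v.2 := by
          gcongr
          exact le_max_right _ _
      _ = q * (a * p v.1 + σ v.2) := by ring

-- The shear `(x, z) ↦ (x - L z, z)` subtracts from `x` its steady state under frozen `z`.
theorem powerStable_blockOp_of_shear {T : X →L[𝕜] X} {b L : Z →L[𝕜] X} {W : X →L[𝕜] Z}
    {d : Z →L[𝕜] Z} (hL : L = T ∘L L + b)
    (h : PowerStable (blockOp (T - L ∘L W) (-(L ∘L (W ∘L L + d))) W (1 + (W ∘L L + d)))) :
    PowerStable (blockOp T b W (1 + d)) := by
  refine h.of_semiconjBy (s := blockOp 1 (-L) 0 1) (t := blockOp 1 L 0 1) ?_ ?_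
  · ext v <;> simp
  · have hb (z : Z) : b z = L z - T (L z) := eq_sub_of_add_eq' (DFunLike.congr_fun hL z).symm
    refine ContinuousLinearMap.ext fun v => Prod.ext ?_ ?_ <;>
    · simp only [mul_apply_eq_comp, blockOp_apply, one_apply_eq_self, zero_apply, neg_apply,
        sub_apply, add_apply, ContinuousLinearMap.comp_apply, map_add, map_neg, map_zero,
        hb]
      abel

end NontriviallyNormedField

theorem eventually_small_gain {q κ : ℝ} (hq : q < 1) (hκ : 0 < κ) (k₁ k₂ k₃ : ℝ) :
    ∀ᶠ ε : ℝ in 𝓝[>] 0, q + ε * k₁ < 1 ∧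
      ε ^ 2 * k₂ * k₃ < (1 - (q + ε * k₁)) * (1 - (1 - κ * ε)) := by
  have h₁ : ∀ᶠ ε : ℝ in 𝓝 0, q + ε * k₁ < 1 :=
    ContinuousAt.eventually_lt (by fun_prop) continuousAt_const (by simpa using hq)
  have h₂ : ∀ᶠ ε : ℝ in 𝓝 0, ε * k₂ * k₃ < (1 - (q + ε * k₁)) * κ :=
    ContinuousAt.eventually_lt (by fun_prop) (by fun_prop)
      (by simpa using mul_pos (sub_pos.2 hq) hκ)
  filter_upwards [nhdsWithin_le_nhds h₁, nhdsWithin_le_nhds h₂, self_mem_nhdsWithin]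
    with ε hε₁ hε₂ hε
  refine ⟨hε₁, ?_⟩
  calc ε ^ 2 * k₂ * k₃ = ε * (ε * k₂ * k₃) := by ring
    _ < ε * ((1 - (q + ε * k₁)) * κ) := mul_lt_mul_of_pos_left hε₂ hε
    _ = (1 - (q + ε * k₁)) * (1 - (1 - κ * ε)) := by ring

theorem eventually_powerStable_blockOp_smul {X Z : Type*}
    [NormedAddCommGroup X] [NormedSpace ℂ X] [CompleteSpace X]
    [NormedAddCommGroup Z] [NormedSpace ℂ Z] [CompleteSpace Z]
    {T : X →L[ℂ] X} (hT : PowerStable T) {b : Z →L[ℂ] X} {W : X →L[ℂ] Z} {d : Z →L[ℂ] Z}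
    (hS : ∀ μ ∈ spectrum ℂ (W ∘L Ring.inverse (1 - T) ∘L b + d), μ.re < 0) :
    ∀ᶠ ε : ℝ in 𝓝[>] 0, PowerStable (blockOp T ((ε : ℂ) • b) W (1 + (ε : ℂ) • d)) := by
  set L := Ring.inverse (1 - T) ∘L b
  set S := W ∘L L + d with hS_def
  have hL : L = T ∘L L + b := ContinuousLinearMap.ext fun z =>
    (eq_map_add_iff_eq_inverse_one_sub hT.isUnit_one_sub).2 rfl
  obtain ⟨p, C, q, hp, hq, hpT⟩ := hT.exists_isEquivSeminorm
  obtain ⟨σ, D, κ, hσ, hκ, hσS⟩ := exists_isEquivSeminorm_add_smul_le hS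
  filter_upwards [self_mem_nhdsWithin, hσS, eventually_small_gain hq hκ (C * ‖L ∘L W‖)
    (C * ‖L ∘L S‖) (D * ‖W‖)] with ε (hε : 0 < ε) hεS ⟨hα, hgain⟩
  have hnorm : ‖(ε : ℂ)‖ = ε := by rw [Complex.norm_real, Real.norm_of_nonneg hε.le]
  have hεS_eq : W ∘L ((ε : ℂ) • L) + (ε : ℂ) • d = (ε : ℂ) • S := by
    rw [hS_def, smul_add, ContinuousLinearMap.comp_smul]
  refine powerStable_blockOp_of_shear (L := (ε : ℂ) • L) ?_ ?_
  · rw [ContinuousLinearMap.comp_smul, ← smul_add, ← hL]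
  rw [hεS_eq]
  refine powerStable_blockOp_of_small_gain hp hσ hα (by positivity) (by positivity) hgain
    (fun x => ?_) (fun z => ?_) (hp.map_le hσ W) hεS
  · calc p ((T - ((ε : ℂ) • L) ∘L W) x) = p (T x - (ε : ℂ) • (L ∘L W) x) := rfl
      _ ≤ p (T x) + ε * p ((L ∘L W) x) := by
          rw [← hnorm, ← map_smul_eq_mul p, hnorm]
          exact map_sub_le_add p _ _
      _ ≤ q * p x + ε * (C * ‖L ∘L W‖ * p x) := by
          gcongr
          exacts [hpT x, hp.map_le hp _ x]
      _ = (q + ε * (C * ‖L ∘L W‖)) * p x := by ring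
  · calc p ((-(((ε : ℂ) • L) ∘L ((ε : ℂ) • S))) z) = p ((ε : ℂ) • (ε : ℂ) • (L ∘L S) z) := by
          simp
      _ = ε ^ 2 * p ((L ∘L S) z) := by
          rw [map_smul_eq_mul, map_smul_eq_mul, hnorm]
          ring
      _ ≤ ε ^ 2 * (C * ‖L ∘L S‖ * σ z) := by gcongr; exact hσ.map_le hp _ z
      _ = ε ^ 2 * (C * ‖L ∘L S‖) * σ z := by ring

end BlockOperator

section LiftedSystem

variable {τ : ℝ} {X U₀ Ud₀ Y₀ Z : Type*}
  [NormedAddCommGroup X] [NormedSpace ℂ X]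
  [NormedAddCommGroup U₀] [InnerProductSpace ℂ U₀]
  [NormedAddCommGroup Ud₀] [InnerProductSpace ℂ Ud₀]
  [NormedAddCommGroup Y₀] [InnerProductSpace ℂ Y₀]
  [NormedAddCommGroup Z] [NormedSpace ℂ Z]

namespace PeriodicSystem

/-- The forcing `B u + B_d w` of the state equation over one period. -/
def forcing (sys : PeriodicSystem τ X U₀ Ud₀ Y₀) (u : L2 τ U₀) (w : L2 τ Ud₀) : L2 τ X :=
  mulOp τ sys.B sys.memLp_B u + mulOp τ sys.Bd sys.memLp_Bd w

theorem forcing_ae_eq (sys : PeriodicSystem τ X U₀ Ud₀ Y₀) {u : ℝ → U₀} {v : ℕ → L2 τ U₀}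
    (hu : ∀ n : ℕ, (fun s => u (n * τ + s)) =ᵐ[periodMeasure τ] v n) (wd : PeriodicSignal τ Ud₀)
    (n : ℕ) :
    (fun s => sys.B (n * τ + s) (u (n * τ + s)) + sys.Bd (n * τ + s) (wd (n * τ + s)))
      =ᵐ[periodMeasure τ] sys.forcing (v n) wd.toL2 := by
  filter_upwards [hu n, wd.memLp.coeFn_toLp, coeFn_mulOp τ sys.B sys.memLp_B (v n),
    coeFn_mulOp τ sys.Bd sys.memLp_Bd wd.toL2,
    Lp.coeFn_add (mulOp τ sys.B sys.memLp_B (v n)) (mulOp τ sys.Bd sys.memLp_Bd wd.toL2)]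
    with s hus hws hBs hBds hadd
  have hB := sys.periodic_B.nat_mul n s
  have hBd := sys.periodic_Bd.nat_mul n s
  have hw := wd.periodic.nat_mul n s
  rw [add_comm] at hB hBd hw
  rw [forcing, hadd, Pi.add_apply, hBs, hBds, hus, hB, hBd, hw, PeriodicSignal.toL2, hws]

variable [CompleteSpace X]

/-- The effect of the control over one period on the state at the end of the period. -/
def inputOp (sys : PeriodicSystem τ X U₀ Ud₀ Y₀) : L2 τ U₀ →L[ℂ] X :=
  sys.terminalOp ∘L mulOp τ sys.B sys.memLp_B

/-- The effect of the disturbance over one period on the state at the end of the period. -/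
def distInputOp (sys : PeriodicSystem τ X U₀ Ud₀ Y₀) : L2 τ Ud₀ →L[ℂ] X :=
  sys.terminalOp ∘L mulOp τ sys.Bd sys.memLp_Bd

/-- The output over one period of the free motion. -/
def outputOp (sys : PeriodicSystem τ X U₀ Ud₀ Y₀) : X →L[ℂ] L2 τ Y₀ :=
  mulOp τ sys.C sys.memLp_C ∘L sys.freeOp

/-- The output over one period that the control generates from the zero state. -/
def feedthroughOp (sys : PeriodicSystem τ X U₀ Ud₀ Y₀) : L2 τ U₀ →L[ℂ] L2 τ Y₀ :=
  mulOp τ sys.C sys.memLp_C ∘L sys.forcedOp ∘L mulOp τ sys.B sys.memLp_B + mulOp τ sys.D sys.memLp_D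

/-- The output over one period that the disturbance generates from the zero state. -/
def distFeedthroughOp (sys : PeriodicSystem τ X U₀ Ud₀ Y₀) : L2 τ Ud₀ →L[ℂ] L2 τ Y₀ :=
  mulOp τ sys.C sys.memLp_C ∘L sys.forcedOp ∘L mulOp τ sys.Bd sys.memLp_Bd

theorem P_eq (sys : PeriodicSystem τ X U₀ Ud₀ Y₀) :
    sys.P = sys.outputOp ∘L sys.monodromyResolvent ∘L sys.inputOp + sys.feedthroughOp := by
  rw [P, sys.steadyStateOp_eq, ContinuousLinearMap.add_comp, ContinuousLinearMap.comp_add,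
    add_assoc]
  rfl

theorem Pd_eq (sys : PeriodicSystem τ X U₀ Ud₀ Y₀) :
    sys.Pd =
      sys.outputOp ∘L sys.monodromyResolvent ∘L sys.distInputOp + sys.distFeedthroughOp := by
  rw [Pd, sys.steadyStateOp_eq, ContinuousLinearMap.add_comp, ContinuousLinearMap.comp_add]
  rfl

theorem terminalOp_forcing (sys : PeriodicSystem τ X U₀ Ud₀ Y₀) (u : L2 τ U₀) (w : L2 τ Ud₀) :
    sys.terminalOp (sys.forcing u w) = sys.inputOp u + sys.distInputOp w :=
  map_add _ _ _

section MildState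

variable (sys : PeriodicSystem τ X U₀ Ud₀ Y₀) {x : ℝ → X} {u : ℝ → U₀} {v : ℕ → L2 τ U₀}
  {wd : PeriodicSignal τ Ud₀} {x₀ : X}
  (hu : ∀ n : ℕ, (fun s => u (n * τ + s)) =ᵐ[periodMeasure τ] v n)
  (hx : ∀ t, 0 ≤ t → x t = sys.evol t 0 x₀ +
    ∫ s in (0 : ℝ)..t, sys.evol t s (sys.B s (u s) + sys.Bd s (wd s)))
include hu hx

theorem state_nat_mul_add (n : ℕ) {t : ℝ} (ht : t ∈ Icc 0 τ) :
    x (n * τ + t) = sys.evol t 0 (x (n * τ)) +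
      ∫ s in (0 : ℝ)..t, sys.evol t s (sys.forcing (v n) wd.toL2 s) := by
  have hf := sys.forcing_ae_eq hu wd
  rw [sys.mild_nat_mul_add (fun n => (integrable_coeFn_L2 _).congr (hf n).symm) hx n ht.1,
    intervalIntegral.integral_of_le ht.1, intervalIntegral.integral_of_le ht.1]
  congr 1
  refine integral_congr_ae ?_
  filter_upwards [ae_restrict_of_ae_restrict_of_subset (Ioc_subset_Ioc_right ht.2) (hf n)] with s hs
  exact congrArg _ hs

theorem state_nat_succ_mul (n : ℕ) : x ((n + 1 : ℕ) * τ) =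
    sys.evol τ 0 (x (n * τ)) + (sys.inputOp (v n) + sys.distInputOp wd.toL2) := by
  rw [← terminalOp_forcing, sys.terminalOp_apply,
    ← sys.state_nat_mul_add hu hx n ⟨sys.period_pos.le, le_rfl⟩, Nat.cast_succ, add_one_mul]

theorem output_nat_mul_add_ae_eq (n : ℕ) :
    (fun s => sys.C (n * τ + s) (x (n * τ + s)) + sys.D (n * τ + s) (u (n * τ + s)))
      =ᵐ[periodMeasure τ] (sys.outputOp (x (n * τ)) + sys.feedthroughOp (v n) +
        sys.distFeedthroughOp wd.toL2 : L2 τ Y₀) := by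
  set g := sys.forcing (v n) wd.toL2 with hg
  have hsum : sys.outputOp (x (n * τ)) + sys.feedthroughOp (v n) +
      sys.distFeedthroughOp wd.toL2 = mulOp τ sys.C sys.memLp_C
        (sys.freeOp (x (n * τ)) + sys.forcedOp g) + mulOp τ sys.D sys.memLp_D (v n) := by
    simp only [hg, forcing, outputOp, feedthroughOp, distFeedthroughOp, add_apply,
      ContinuousLinearMap.comp_apply, map_add]
    abel
  rw [hsum]
  filter_upwards [hu n, coeFn_mulOp τ sys.C sys.memLp_C
      (sys.freeOp (x (n * τ)) + sys.forcedOp g),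
    coeFn_mulOp τ sys.D sys.memLp_D (v n), sys.coeFn_freeOp (x (n * τ)), sys.coeFn_forcedOp g,
    Lp.coeFn_add (sys.freeOp (x (n * τ))) (sys.forcedOp g),
    Lp.coeFn_add (mulOp τ sys.C sys.memLp_C (sys.freeOp (x (n * τ)) + sys.forcedOp g))
      (mulOp τ sys.D sys.memLp_D (v n)), ae_restrict_mem measurableSet_Ioc]
    with s hus hCs hDs hfree hforced hadd hsum hs
  have hC := sys.periodic_C.nat_mul n s
  have hD := sys.periodic_D.nat_mul n s
  rw [add_comm] at hC hD
  rw [hsum, Pi.add_apply, hCs, hDs, hadd, Pi.add_apply, hfree, hforced, hus, hC, hD,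
    sys.state_nat_mul_add hu hx n ⟨hs.1.le, hs.2⟩]

end MildState

/-- One step of the lifted closed-loop system, which records the plant and controller states at the
sampling instants `nτ`. -/
def closedLoopOp (sys : PeriodicSystem τ X U₀ Ud₀ Y₀) (ctrl : Controller τ U₀ Y₀ Z) :
    X × Z →L[ℂ] X × Z :=
  blockOp (sys.evol τ 0) (sys.inputOp ∘L ctrl.K) (ctrl.G₂ ∘L sys.outputOp)
    (ctrl.G₁ + ctrl.G₂ ∘L sys.feedthroughOp ∘L ctrl.K)

/-- The regulation error over one period as a function of the lifted closed-loop state. -/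
def stateToError (sys : PeriodicSystem τ X U₀ Ud₀ Y₀) (ctrl : Controller τ U₀ Y₀ Z) :
    X × Z →L[ℂ] L2 τ Y₀ :=
  sys.outputOp.coprod (sys.feedthroughOp ∘L ctrl.K)

/-- The direct effect on the regulation error of the exogenous signals `(w_dist, y_ref)`. -/
def exoToError (sys : PeriodicSystem τ X U₀ Ud₀ Y₀) : L2 τ Ud₀ × L2 τ Y₀ →L[ℂ] L2 τ Y₀ :=
  sys.distFeedthroughOp.coprod (-ContinuousLinearMap.id ℂ _)

/-- The forcing of the lifted closed-loop system by the exogenous signals `(w_dist, y_ref)`. -/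
def exoToState (sys : PeriodicSystem τ X U₀ Ud₀ Y₀) (ctrl : Controller τ U₀ Y₀ Z) :
    L2 τ Ud₀ × L2 τ Y₀ →L[ℂ] X × Z :=
  (sys.distInputOp ∘L ContinuousLinearMap.fst ℂ _ _).prod (ctrl.G₂ ∘L sys.exoToError)

theorem closedLoopOp_add_exoToState (sys : PeriodicSystem τ X U₀ Ud₀ Y₀)
    (ctrl : Controller τ U₀ Y₀ Z) (ξ : X × Z) (d : L2 τ Ud₀ × L2 τ Y₀) :
    sys.closedLoopOp ctrl ξ + sys.exoToState ctrl d =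
      (sys.evol τ 0 ξ.1 + (sys.inputOp (ctrl.K ξ.2) + sys.distInputOp d.1),
        ctrl.G₁ ξ.2 + ctrl.G₂ (sys.stateToError ctrl ξ + sys.exoToError d)) := by
  refine Prod.ext (add_assoc _ _ _) ?_
  simp only [closedLoopOp, exoToState, stateToError, blockOp_apply, Prod.snd_add, add_apply,
    ContinuousLinearMap.prod_apply, ContinuousLinearMap.coprod_apply,
    ContinuousLinearMap.comp_apply, map_add]
  abel

theorem error_nat_mul_add_ae_eq (sys : PeriodicSystem τ X U₀ Ud₀ Y₀) (ctrl : Controller τ U₀ Y₀ Z)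
    {x : ℝ → X} {u : ℝ → U₀} {z : ℕ → Z} {yref : PeriodicSignal τ Y₀} {wd : PeriodicSignal τ Ud₀}
    {x₀ : X} (hu : ∀ n : ℕ, (fun s => u (n * τ + s)) =ᵐ[periodMeasure τ] ctrl.K (z n))
    (hx : ∀ t, 0 ≤ t → x t = sys.evol t 0 x₀ +
      ∫ s in (0 : ℝ)..t, sys.evol t s (sys.B s (u s) + sys.Bd s (wd s))) (n : ℕ) :
    (fun s => sys.C (n * τ + s) (x (n * τ + s)) + sys.D (n * τ + s) (u (n * τ + s)) - yref s)
      =ᵐ[periodMeasure τ] (sys.stateToError ctrl (x (n * τ), z n) +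
        sys.exoToError (wd.toL2, yref.toL2) : L2 τ Y₀) := by
  have hsum : sys.stateToError ctrl (x (n * τ), z n) + sys.exoToError (wd.toL2, yref.toL2) =
      sys.outputOp (x (n * τ)) + sys.feedthroughOp (ctrl.K (z n)) +
        sys.distFeedthroughOp wd.toL2 - yref.toL2 := by
    simp only [stateToError, exoToError, ContinuousLinearMap.coprod_apply,
      ContinuousLinearMap.comp_apply, neg_apply, ContinuousLinearMap.id_apply]
    abel
  rw [hsum]
  filter_upwards [sys.output_nat_mul_add_ae_eq hu hx n, yref.memLp.coeFn_toLp,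
    Lp.coeFn_sub (sys.outputOp (x (n * τ)) + sys.feedthroughOp (ctrl.K (z n)) +
      sys.distFeedthroughOp wd.toL2) yref.toL2] with s houtput hyref hsub
  rw [hsub, Pi.sub_apply, ← houtput, PeriodicSignal.toL2, hyref]

end PeriodicSystem

namespace ClosedLoopTrajectory

variable {sys : PeriodicSystem τ X U₀ Ud₀ Y₀} {ctrl : Controller τ U₀ Y₀ Z}
  {yref : PeriodicSignal τ Y₀} {wd : PeriodicSignal τ Ud₀} {x0 : X} {z0 : Z}

/-- The state of the lifted system: plant and controller state at the beginning of a period. -/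
def lifted (T : ClosedLoopTrajectory sys ctrl yref wd x0 z0) (n : ℕ) : X × Z :=
  (T.x (n * τ), T.z n)

theorem lifted_zero (T : ClosedLoopTrajectory sys ctrl yref wd x0 z0) : T.lifted 0 = (x0, z0) := by
  have hx : T.x 0 = x0 := by
    rw [T.state_eq 0 le_rfl, intervalIntegral.integral_same, sys.evol_self, add_zero,
      ContinuousLinearMap.id_apply]
  rw [lifted, Nat.cast_zero, zero_mul, hx, T.z_zero]

variable [CompleteSpace X]

theorem error_eq_lifted (T : ClosedLoopTrajectory sys ctrl yref wd x0 z0) (n : ℕ) :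
    T.e n = sys.stateToError ctrl (T.lifted n) + sys.exoToError (wd.toL2, yref.toL2) := by
  refine Lp.ext ?_
  filter_upwards [T.error_eq n,
    sys.error_nat_mul_add_ae_eq ctrl (yref := yref) T.control_eq T.state_eq n,
    ae_restrict_mem measurableSet_Ioc] with s he hlifted hs
  have hn : 0 ≤ n * τ := mul_nonneg n.cast_nonneg sys.period_pos.le
  rw [he, T.output_eq _ (add_nonneg hn hs.1.le), hlifted, lifted]

theorem lifted_succ (T : ClosedLoopTrajectory sys ctrl yref wd x0 z0) (n : ℕ) :
    T.lifted (n + 1) =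
      sys.closedLoopOp ctrl (T.lifted n) + sys.exoToState ctrl (wd.toL2, yref.toL2) := by
  rw [sys.closedLoopOp_add_exoToState, ← T.error_eq_lifted]
  exact Prod.ext (sys.state_nat_succ_mul T.control_eq T.state_eq n) (T.z_succ n)

end ClosedLoopTrajectory

/-- The concatenation of functions on `(0, τ]` to a function on `(0, ∞)`. -/
def concatPeriods {V : Type*} (τ : ℝ) (v : ℕ → ℝ → V) (t : ℝ) : V :=
  v (⌈t / τ⌉₊ - 1) (t - (⌈t / τ⌉₊ - 1 : ℕ) * τ)

theorem concatPeriods_nat_mul_add {V : Type*} (hτ : 0 < τ) (v : ℕ → ℝ → V) (n : ℕ) {s : ℝ}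
    (hs : s ∈ Ioc 0 τ) : concatPeriods τ v (n * τ + s) = v n s := by
  have hceil : ⌈(n * τ + s) / τ⌉₊ = n + 1 := by
    rw [Nat.ceil_eq_iff n.succ_ne_zero, lt_div_iff₀ hτ, div_le_iff₀ hτ, Nat.succ_sub_one,
      Nat.cast_succ]
    constructor <;> linarith [hs.1, hs.2]
  rw [concatPeriods, hceil, Nat.add_sub_cancel, add_sub_cancel_left]

theorem closedLoopWellPosed [CompleteSpace X] (sys : PeriodicSystem τ X U₀ Ud₀ Y₀)
    (ctrl : Controller τ U₀ Y₀ Z) : ClosedLoopWellPosed sys ctrl := by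
  intro yref wd x0 z0
  let ξ (n : ℕ) : X × Z :=
    (fun ξ => sys.closedLoopOp ctrl ξ + sys.exoToState ctrl (wd.toL2, yref.toL2))^[n] (x0, z0)
  have hξ (n : ℕ) : ξ (n + 1) =
      sys.closedLoopOp ctrl (ξ n) + sys.exoToState ctrl (wd.toL2, yref.toL2) :=
    Function.iterate_succ_apply' _ _ _
  let u : ℝ → U₀ := concatPeriods τ fun n => ctrl.K (ξ n).2
  let x (t : ℝ) : X := sys.evol t 0 x0 +
    ∫ s in (0 : ℝ)..t, sys.evol t s (sys.B s (u s) + sys.Bd s (wd s))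
  have hu (n : ℕ) : (fun s => u (n * τ + s)) =ᵐ[periodMeasure τ] ctrl.K (ξ n).2 := by
    filter_upwards [ae_restrict_mem measurableSet_Ioc] with s hs
    exact concatPeriods_nat_mul_add sys.period_pos _ n hs
  have hx (t : ℝ) (_ : 0 ≤ t) : x t = sys.evol t 0 x0 +
    ∫ s in (0 : ℝ)..t, sys.evol t s (sys.B s (u s) + sys.Bd s (wd s)) := rfl
  have hxξ (n : ℕ) : x (n * τ) = (ξ n).1 := by
    induction n with
    | zero => simp [x, ξ, sys.evol_self]
    | succ n ih => rw [sys.state_nat_succ_mul hu hx n, ih, hξ, sys.closedLoopOp_add_exoToState]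
  exact ⟨{
    x := x
    y := fun t => sys.C t (x t) + sys.D t (u t)
    u := u
    z := fun n => (ξ n).2
    e := fun n => sys.stateToError ctrl (ξ n) + sys.exoToError (wd.toL2, yref.toL2)
    state_eq := hx
    output_eq := fun _ _ => rfl
    control_eq := hu
    error_eq := fun n => by
      have herror := sys.error_nat_mul_add_ae_eq ctrl (yref := yref) hu hx n
      rw [hxξ] at herror
      exact herror.symm
    z_zero := rfl
    z_succ := fun n => by rw [hξ, sys.closedLoopOp_add_exoToState] }⟩

end LiftedSystem

section ClosedLoopStability

variable {τ : ℝ} {X U₀ Ud₀ Y₀ Z : Type*}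
  [NormedAddCommGroup X] [NormedSpace ℂ X]
  [NormedAddCommGroup U₀] [InnerProductSpace ℂ U₀]
  [NormedAddCommGroup Ud₀] [InnerProductSpace ℂ Ud₀]
  [NormedAddCommGroup Y₀] [InnerProductSpace ℂ Y₀]
  [NormedAddCommGroup Z] [NormedSpace ℂ Z]

theorem PeriodicEvolutionFamily.ExponentiallyStable.powerStable {E : PeriodicEvolutionFamily τ X}
    (hE : E.ExponentiallyStable) : PowerStable (E.evol τ 0) := by
  obtain ⟨M, hM, ω, hω, h⟩ := hE
  refine powerStable_iff_exp.2 ⟨M, hM, ω * τ, mul_pos hω E.period_pos, fun n => ?_⟩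
  rw [← E.evol_nat_mul]
  convert h (n * τ) 0 (mul_nonneg n.cast_nonneg E.period_pos.le) using 3
  ring

@[simp]
theorem PeriodicSignal.toL2_zero {V : Type*} [NormedAddCommGroup V] :
    (0 : PeriodicSignal τ V).toL2 = 0 :=
  MemLp.toLp_zero _

theorem exists_nat_mul_add (hτ : 0 < τ) {t : ℝ} (ht : 0 ≤ t) :
    ∃ n : ℕ, ∃ s ∈ Icc 0 τ, n * τ + s = t := by
  have hfloor := (le_div_iff₀ hτ).1 (Nat.floor_le (div_nonneg ht hτ.le))
  have hlt := (div_lt_iff₀ hτ).1 (Nat.lt_floor_add_one (t / τ))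
  exact ⟨⌊t / τ⌋₊, t - ⌊t / τ⌋₊ * τ, ⟨by linarith, by linarith⟩, by ring⟩

variable [CompleteSpace X]

namespace ClosedLoopTrajectory

variable {sys : PeriodicSystem τ X U₀ Ud₀ Y₀} {ctrl : Controller τ U₀ Y₀ Z}

theorem lifted_eq_pow {x0 : X} {z0 : Z} (T : ClosedLoopTrajectory sys ctrl 0 0 x0 z0) (n : ℕ) :
    T.lifted n = (sys.closedLoopOp ctrl ^ n) (x0, z0) := by
  have hsucc (n : ℕ) : T.lifted (n + 1) = sys.closedLoopOp ctrl (T.lifted n) + 0 := by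
    rw [T.lifted_succ, PeriodicSignal.toL2_zero, PeriodicSignal.toL2_zero, Prod.mk_zero_zero,
      map_zero]
  simpa [T.lifted_zero] using affine_iterate_sub_fixedPoint (v' := 0) hsucc (by simp) n

theorem exists_norm_x_le (sys : PeriodicSystem τ X U₀ Ud₀ Y₀) (ctrl : Controller τ U₀ Y₀ Z) :
    ∃ c > 0, ∀ (x0 : X) (z0 : Z) (T : ClosedLoopTrajectory sys ctrl 0 0 x0 z0) (n : ℕ),
      ∀ t ∈ Icc 0 τ, ‖T.x (n * τ + t)‖ ≤ c * ‖T.lifted n‖ := by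
  obtain ⟨M, hM⟩ := sys.exists_bound
  obtain ⟨c, hc₀, hc⟩ := sys.exists_norm_integral_evol_le
  set b := mulOp τ sys.B sys.memLp_B ∘L ctrl.K
  refine ⟨M + c * ‖b‖ + 1, by positivity, fun x0 z0 T n t ht => ?_⟩
  have hforcing : sys.forcing (ctrl.K (T.z n)) (0 : PeriodicSignal τ Ud₀).toL2 = b (T.z n) := by
    rw [PeriodicSystem.forcing, PeriodicSignal.toL2_zero, map_zero, add_zero]
    rfl
  have hfree : ‖sys.evol t 0 (T.x (n * τ))‖ ≤ M * ‖T.lifted n‖ :=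
    (sys.evol t 0).le_of_opNorm_le_of_le (hM t 0 le_rfl ht.1 ht.2) (norm_fst_le (T.lifted n))
  have hforced : ‖∫ s in (0 : ℝ)..t, sys.evol t s (b (T.z n) s)‖ ≤ c * ‖b‖ * ‖T.lifted n‖ := by
    rw [mul_assoc]
    refine (hc _ t ht).trans ?_
    gcongr
    exact b.le_opNorm_of_le (norm_snd_le (T.lifted n))
  rw [sys.state_nat_mul_add T.control_eq T.state_eq n ht, hforcing]
  linarith [norm_add_le (sys.evol t 0 (T.x (n * τ)))
    (∫ s in (0 : ℝ)..t, sys.evol t s (b (T.z n) s)), norm_nonneg (T.lifted n)]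

end ClosedLoopTrajectory

variable {sys : PeriodicSystem τ X U₀ Ud₀ Y₀} {ctrl : Controller τ U₀ Y₀ Z}

theorem closedLoopStable_of_powerStable (h : PowerStable (sys.closedLoopOp ctrl)) :
    ClosedLoopStable sys ctrl := by
  have hτ := sys.period_pos
  obtain ⟨M, hM, α, hα, h⟩ := powerStable_iff_exp.1 h
  obtain ⟨c, hc, hx⟩ := ClosedLoopTrajectory.exists_norm_x_le sys ctrl
  have hlifted (x0 : X) (z0 : Z) (T : ClosedLoopTrajectory sys ctrl 0 0 x0 z0) (n : ℕ) :
      ‖T.lifted n‖ ≤ M * Real.exp (-α * n) * (‖x0‖ + ‖z0‖) := by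
    rw [T.lifted_eq_pow]
    exact ContinuousLinearMap.le_of_opNorm_le_of_le _ (h n) (norm_prod_le_add _)
  refine ⟨c * (M * Real.exp α), by positivity, M, hM, α / τ, by positivity, α, hα,
    fun x0 z0 T => ⟨fun t ht => ?_, fun n => (norm_snd_le (T.lifted n)).trans (hlifted x0 z0 T n)⟩⟩
  obtain ⟨n, s, hs, rfl⟩ := exists_nat_mul_add hτ ht
  have hexp : Real.exp (-α * n) ≤ Real.exp α * Real.exp (-(α / τ) * (n * τ + s)) := by
    rw [← Real.exp_add, Real.exp_le_exp]
    calc -α * n = -(α / τ) * (n * τ) := by field_simp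
      _ ≤ -(α / τ) * (n * τ) + α / τ * (τ - s) :=
        le_add_of_nonneg_right (mul_nonneg (by positivity) (sub_nonneg.2 hs.2))
      _ = α + -(α / τ) * (n * τ + s) := by field_simp; ring
  calc ‖T.x (n * τ + s)‖ ≤ c * ‖T.lifted n‖ := hx x0 z0 T n s hs
    _ ≤ c * (M * Real.exp (-α * n) * (‖x0‖ + ‖z0‖)) := by gcongr; exact hlifted x0 z0 T n
    _ ≤ c * (M * (Real.exp α * Real.exp (-(α / τ) * (n * τ + s))) * (‖x0‖ + ‖z0‖)) := by gcongr
    _ = c * (M * Real.exp α) * Real.exp (-(α / τ) * (n * τ + s)) * (‖x0‖ + ‖z0‖) := by ring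

theorem powerStable_of_closedLoopStable (h : ClosedLoopStable sys ctrl) :
    PowerStable (sys.closedLoopOp ctrl) := by
  have hτ := sys.period_pos
  obtain ⟨M₀, hM₀, M₁, hM₁, α₀, hα₀, α₁, hα₁, h⟩ := h
  let α := min (α₀ * τ) α₁
  have hexp₀ (n : ℕ) : Real.exp (-α₀ * (n * τ)) ≤ Real.exp (-α * n) := by
    have := mul_le_mul_of_nonneg_right (min_le_left (α₀ * τ) α₁) (n.cast_nonneg (α := ℝ))
    exact Real.exp_le_exp.2 (by linarith)
  have hexp₁ (n : ℕ) : Real.exp (-α₁ * n) ≤ Real.exp (-α * n) := by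
    have := mul_le_mul_of_nonneg_right (min_le_right (α₀ * τ) α₁) (n.cast_nonneg (α := ℝ))
    exact Real.exp_le_exp.2 (by linarith)
  refine powerStable_iff_exp.2 ⟨(M₀ + M₁) * 2, by positivity, α, by positivity, fun n =>
    ContinuousLinearMap.opNorm_le_bound _ (by positivity) fun v => ?_⟩
  obtain ⟨T⟩ := closedLoopWellPosed sys ctrl 0 0 v.1 v.2
  obtain ⟨hx, hz⟩ := h v.1 v.2 T
  calc ‖(sys.closedLoopOp ctrl ^ n) v‖ = ‖T.lifted n‖ := by rw [T.lifted_eq_pow]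
    _ ≤ ‖T.x (n * τ)‖ + ‖T.z n‖ := norm_prod_le_add _
    _ ≤ M₀ * Real.exp (-α₀ * (n * τ)) * (‖v.1‖ + ‖v.2‖) +
        M₁ * Real.exp (-α₁ * n) * (‖v.1‖ + ‖v.2‖) := add_le_add (hx _ (by positivity)) (hz n)
    _ ≤ M₀ * Real.exp (-α * n) * (‖v‖ + ‖v‖) + M₁ * Real.exp (-α * n) * (‖v‖ + ‖v‖) := by
      gcongr M₀ * ?_ * (?_ + ?_) + M₁ * ?_ * (?_ + ?_)
      exacts [hexp₀ n, norm_fst_le v, norm_snd_le v, hexp₁ n, norm_fst_le v, norm_snd_le v]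
    _ = (M₀ + M₁) * 2 * Real.exp (-α * n) * ‖v‖ := by ring

theorem closedLoopStable_iff_powerStable :
    ClosedLoopStable sys ctrl ↔ PowerStable (sys.closedLoopOp ctrl) :=
  ⟨powerStable_of_closedLoopStable, closedLoopStable_of_powerStable⟩

end ClosedLoopStability

section AsymptoticError

variable {τ : ℝ} {X U₀ Ud₀ Y₀ Z : Type*}
  [NormedAddCommGroup X] [NormedSpace ℂ X] [CompleteSpace X]
  [NormedAddCommGroup U₀] [InnerProductSpace ℂ U₀]
  [NormedAddCommGroup Ud₀] [InnerProductSpace ℂ Ud₀]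
  [NormedAddCommGroup Y₀] [InnerProductSpace ℂ Y₀]
  [NormedAddCommGroup Z] [NormedSpace ℂ Z]

namespace PeriodicSystem

/-- The equilibrium of the lifted closed-loop system as a function of the exogenous signals
`(w_dist, y_ref)`, meaningful when `1 - closedLoopOp` is invertible. -/
def equilibriumOp (sys : PeriodicSystem τ X U₀ Ud₀ Y₀) (ctrl : Controller τ U₀ Y₀ Z) :
    L2 τ Ud₀ × L2 τ Y₀ →L[ℂ] X × Z :=
  Ring.inverse (1 - sys.closedLoopOp ctrl) ∘L sys.exoToState ctrl

/-- The regulation error at the equilibrium of the lifted closed-loop system. -/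
def asymptoticErrorOp (sys : PeriodicSystem τ X U₀ Ud₀ Y₀) (ctrl : Controller τ U₀ Y₀ Z) :
    L2 τ Ud₀ × L2 τ Y₀ →L[ℂ] L2 τ Y₀ :=
  sys.stateToError ctrl ∘L sys.equilibriumOp ctrl + sys.exoToError

variable {sys : PeriodicSystem τ X U₀ Ud₀ Y₀} {ctrl : Controller τ U₀ Y₀ Z}

theorem eq_closedLoopOp_add_iff_eq_equilibriumOp (h : IsUnit (1 - sys.closedLoopOp ctrl))
    {ξ : X × Z} {d : L2 τ Ud₀ × L2 τ Y₀} :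
    ξ = sys.closedLoopOp ctrl ξ + sys.exoToState ctrl d ↔ ξ = sys.equilibriumOp ctrl d :=
  eq_map_add_iff_eq_inverse_one_sub h

theorem equilibriumOp_eq_closedLoopOp_add (h : IsUnit (1 - sys.closedLoopOp ctrl))
    (d : L2 τ Ud₀ × L2 τ Y₀) : sys.equilibriumOp ctrl d =
      sys.closedLoopOp ctrl (sys.equilibriumOp ctrl d) + sys.exoToState ctrl d :=
  (eq_closedLoopOp_add_iff_eq_equilibriumOp h).2 rfl

theorem eq_closedLoopOp_add_iff (hE : IsUnit (1 - sys.evol τ 0))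
    (hG₁ : ctrl.G₁ = ContinuousLinearMap.id ℂ Z) {ξ : X × Z} {d : L2 τ Ud₀ × L2 τ Y₀} :
    ξ = sys.closedLoopOp ctrl ξ + sys.exoToState ctrl d ↔
      ξ.1 = sys.monodromyResolvent (sys.inputOp (ctrl.K ξ.2) + sys.distInputOp d.1) ∧
        ctrl.G₂ (sys.stateToError ctrl ξ + sys.exoToError d) = 0 := by
  rw [closedLoopOp_add_exoToState, Prod.ext_iff, hG₁, ContinuousLinearMap.id_apply,
    left_eq_add, eq_map_add_iff_eq_inverse_one_sub hE]
  rfl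

theorem stateToError_add_exoToError_of_fst_eq {ξ : X × Z} {d : L2 τ Ud₀ × L2 τ Y₀}
    (hξ : ξ.1 = sys.monodromyResolvent (sys.inputOp (ctrl.K ξ.2) + sys.distInputOp d.1)) :
    sys.stateToError ctrl ξ + sys.exoToError d =
      sys.P (ctrl.K ξ.2) + sys.Pd d.1 - d.2 := by
  simp only [stateToError, exoToError, P_eq, Pd_eq, ContinuousLinearMap.coprod_apply, hξ, map_add,
    add_apply, neg_apply, ContinuousLinearMap.comp_apply, ContinuousLinearMap.id_apply]
  abel

theorem G₂_asymptoticErrorOp (hG₁ : ctrl.G₁ = ContinuousLinearMap.id ℂ Z)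
    (h : IsUnit (1 - sys.closedLoopOp ctrl)) (d : L2 τ Ud₀ × L2 τ Y₀) :
    ctrl.G₂ (sys.asymptoticErrorOp ctrl d) = 0 := by
  have hsnd := congrArg Prod.snd (equilibriumOp_eq_closedLoopOp_add h d)
  rw [closedLoopOp_add_exoToState, hG₁] at hsnd
  exact left_eq_add.1 hsnd

theorem asymptoticErrorOp_apply_eq (hE : IsUnit (1 - sys.evol τ 0))
    (hG₁ : ctrl.G₁ = ContinuousLinearMap.id ℂ Z) (h : IsUnit (1 - sys.closedLoopOp ctrl))
    (d : L2 τ Ud₀ × L2 τ Y₀) : sys.asymptoticErrorOp ctrl d =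
      sys.P (ctrl.K (sys.equilibriumOp ctrl d).2) + sys.Pd d.1 - d.2 := by
  have hfst := ((eq_closedLoopOp_add_iff hE hG₁).1 (equilibriumOp_eq_closedLoopOp_add h d)).1
  rw [← stateToError_add_exoToError_of_fst_eq hfst, asymptoticErrorOp, add_apply,
    ContinuousLinearMap.comp_apply]

theorem G₂_P_add_Pd_sub_eq_zero_iff (hE : IsUnit (1 - sys.evol τ 0))
    (hG₁ : ctrl.G₁ = ContinuousLinearMap.id ℂ Z) (h : IsUnit (1 - sys.closedLoopOp ctrl))
    {d : L2 τ Ud₀ × L2 τ Y₀} {z : Z} :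
    ctrl.G₂ (sys.P (ctrl.K z) + sys.Pd d.1 - d.2) = 0 ↔ z = (sys.equilibriumOp ctrl d).2 := by
  constructor
  · intro hz
    let ξ : X × Z := (sys.monodromyResolvent (sys.inputOp (ctrl.K z) + sys.distInputOp d.1), z)
    have hξ : ξ = sys.closedLoopOp ctrl ξ + sys.exoToState ctrl d :=
      (eq_closedLoopOp_add_iff hE hG₁).2
        ⟨rfl, by rw [stateToError_add_exoToError_of_fst_eq rfl]; exact hz⟩
    exact congrArg Prod.snd ((eq_closedLoopOp_add_iff_eq_equilibriumOp h).1 hξ)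
  · rintro rfl
    rw [← asymptoticErrorOp_apply_eq hE hG₁ h]
    exact G₂_asymptoticErrorOp hG₁ h d

end PeriodicSystem

variable {sys : PeriodicSystem τ X U₀ Ud₀ Y₀} {ctrl : Controller τ U₀ Y₀ Z}

theorem ClosedLoopTrajectory.error_sub_asymptoticErrorOp
    (h : IsUnit (1 - sys.closedLoopOp ctrl)) {yref : PeriodicSignal τ Y₀}
    {wd : PeriodicSignal τ Ud₀} {x0 : X} {z0 : Z}
    (T : ClosedLoopTrajectory sys ctrl yref wd x0 z0) (n : ℕ) :
    T.e n - sys.asymptoticErrorOp ctrl (wd.toL2, yref.toL2) =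
      sys.stateToError ctrl ((sys.closedLoopOp ctrl ^ n)
        ((x0, z0) - sys.equilibriumOp ctrl (wd.toL2, yref.toL2))) := by
  rw [T.error_eq_lifted, PeriodicSystem.asymptoticErrorOp, add_apply,
    ContinuousLinearMap.comp_apply, add_sub_add_right_eq_sub, ← map_sub,
    affine_iterate_sub_fixedPoint T.lifted_succ
      (PeriodicSystem.equilibriumOp_eq_closedLoopOp_add h _), T.lifted_zero]

variable [CompleteSpace Z]

theorem errorConvergesTo_asymptoticErrorOp (h : PowerStable (sys.closedLoopOp ctrl)) :
    ErrorConvergesTo sys ctrl fun yref wd =>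
      sys.asymptoticErrorOp ctrl (wd.toL2, yref.toL2) := by
  have hunit := h.isUnit_one_sub
  obtain ⟨M, hM, α, hα, h⟩ := powerStable_iff_exp.1 h
  set O := sys.stateToError ctrl
  set R := sys.equilibriumOp ctrl
  refine ⟨(‖O‖ + 1) * M * (‖R‖ + 1), by positivity, α, hα, fun yref wd x0 z0 T n => ?_⟩
  rw [T.error_sub_asymptoticErrorOp hunit]
  set d := (wd.toL2, yref.toL2)
  set E := Real.exp (-α * n)
  have hξ : ‖(x0, z0)‖ ≤ ‖x0‖ + ‖z0‖ := norm_prod_le_add _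
  have hd : ‖d‖ ≤ ‖wd.toL2‖ + ‖yref.toL2‖ := norm_prod_le_add _
  calc ‖O ((sys.closedLoopOp ctrl ^ n) ((x0, z0) - R d))‖
      ≤ ‖O‖ * (M * E * (‖(x0, z0)‖ + ‖R‖ * ‖d‖)) :=
        O.le_opNorm_of_le (ContinuousLinearMap.le_of_opNorm_le_of_le _ (h n)
          ((norm_sub_le _ _).trans (by gcongr; exact R.le_opNorm d)))
    _ ≤ (‖O‖ + 1) * (M * E * ((‖R‖ + 1) * (‖(x0, z0)‖ + ‖d‖))) := by
      gcongr
      · exact le_add_of_nonneg_right zero_le_one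
      · linarith [mul_nonneg (norm_nonneg R) (norm_nonneg (x0, z0)), norm_nonneg d]
    _ = (‖O‖ + 1) * M * (‖R‖ + 1) * E * (‖(x0, z0)‖ + ‖d‖) := by ring
    _ ≤ (‖O‖ + 1) * M * (‖R‖ + 1) * E * (‖x0‖ + ‖z0‖ + ‖yref.toL2‖ + ‖wd.toL2‖) :=
      mul_le_mul_of_nonneg_left (by linarith) (by positivity)

theorem hasApproximateRegulationError (hE : IsUnit (1 - sys.evol τ 0))
    (hG₁ : ctrl.G₁ = ContinuousLinearMap.id ℂ Z) {YN : Submodule ℂ (L2 τ Y₀)}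
    {Q : L2 τ Y₀ →L[ℂ] YN} (hG₂ : ∀ y, ctrl.G₂ y = 0 ↔ Q y = 0)
    (h : PowerStable (sys.closedLoopOp ctrl)) : HasApproximateRegulationError sys ctrl Q := by
  have hunit := h.isUnit_one_sub
  refine ⟨fun yref wd => (sys.equilibriumOp ctrl (wd.toL2, yref.toL2)).2, fun yref wd z => ?_, ?_⟩
  · rw [← PeriodicSystem.G₂_P_add_Pd_sub_eq_zero_iff hE hG₁ hunit, hG₂, map_sub, map_add,
      sub_eq_zero, eq_sub_iff_add_eq]
  · convert errorConvergesTo_asymptoticErrorOp h using 3 with yref wd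
    have hQ := (hG₂ _).1
      (PeriodicSystem.G₂_asymptoticErrorOp hG₁ hunit (wd.toL2, yref.toL2))
    rw [← PeriodicSystem.asymptoticErrorOp_apply_eq hE hG₁ hunit, sub_apply,
      ContinuousLinearMap.comp_apply, hQ, map_zero, ContinuousLinearMap.id_apply, sub_zero]

end AsymptoticError

theorem PeriodicSystem.eventually_powerStable_closedLoopOp {τ : ℝ} {X U₀ Ud₀ Y₀ Z : Type*}
    [NormedAddCommGroup X] [NormedSpace ℂ X] [CompleteSpace X]
    [NormedAddCommGroup U₀] [InnerProductSpace ℂ U₀]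
    [NormedAddCommGroup Ud₀] [InnerProductSpace ℂ Ud₀]
    [NormedAddCommGroup Y₀] [InnerProductSpace ℂ Y₀]
    [NormedAddCommGroup Z] [NormedSpace ℂ Z] [CompleteSpace Z]
    {sys : PeriodicSystem τ X U₀ Ud₀ Y₀} (hsys : PowerStable (sys.evol τ 0))
    {G₂ : L2 τ Y₀ →L[ℂ] Z} {K₀ : Z →L[ℂ] L2 τ U₀}
    (hK₀ : ∀ μ ∈ spectrum ℂ (G₂ ∘L sys.P ∘L K₀), μ.re < 0) :
    ∀ᶠ ε : ℝ in 𝓝[>] 0, PowerStable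
      (sys.closedLoopOp ⟨ContinuousLinearMap.id ℂ Z, G₂, (ε : ℂ) • K₀⟩) := by
  have hS : G₂ ∘L sys.P ∘L K₀ = (G₂ ∘L sys.outputOp) ∘L Ring.inverse (1 - sys.evol τ 0) ∘L
      (sys.inputOp ∘L K₀) + G₂ ∘L sys.feedthroughOp ∘L K₀ := by
    rw [sys.P_eq, ContinuousLinearMap.add_comp, ContinuousLinearMap.comp_add]
    rfl
  filter_upwards [eventually_powerStable_blockOp_smul hsys (hS ▸ hK₀)] with ε hε
  simpa only [closedLoopOp, ContinuousLinearMap.comp_smul, ContinuousLinearMap.one_def] using hε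

theorem mainTheorem4_general {τ : ℝ} {X U₀ Ud₀ Y₀ Z : Type*}
    [NormedAddCommGroup X] [NormedSpace ℂ X] [CompleteSpace X]
    [NormedAddCommGroup U₀] [InnerProductSpace ℂ U₀]
    [NormedAddCommGroup Ud₀] [InnerProductSpace ℂ Ud₀]
    [NormedAddCommGroup Y₀] [InnerProductSpace ℂ Y₀]
    [NormedAddCommGroup Z] [NormedSpace ℂ Z] [CompleteSpace Z]
    (sys : PeriodicSystem τ X U₀ Ud₀ Y₀) (hsys : sys.ExponentiallyStable)
    (YN : Submodule ℂ (L2 τ Y₀)) (QN : L2 τ Y₀ →L[ℂ] YN)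
    (G₂₀ : YN →L[ℂ] Z) (hG₂₀ : Function.Injective G₂₀) (K₀ : Z →L[ℂ] L2 τ U₀)
    (hK₀ : ∀ μ ∈ spectrum ℂ ((G₂₀ ∘L QN) ∘L sys.P ∘L K₀), μ.re < 0) :
    ∃ εstar : ℝ, 0 < εstar ∧ ∀ ε : ℝ, 0 < ε → ε ≤ εstar →
      ∀ ctrl : Controller τ U₀ Y₀ Z,
        ctrl = { G₁ := ContinuousLinearMap.id ℂ Z
                 G₂ := G₂₀ ∘L QN
                 K := (ε : ℂ) • K₀ } →
        (ClosedLoopWellPosed sys ctrl ∧ ClosedLoopStable sys ctrl ∧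
          HasApproximateRegulationError sys ctrl QN) ∧
        (∀ sys' : PeriodicSystem τ X U₀ Ud₀ Y₀, ClosedLoopStable sys' ctrl →
          ClosedLoopWellPosed sys' ctrl ∧
          (∃ err : PeriodicSignal τ Y₀ → PeriodicSignal τ Ud₀ → L2 τ Y₀,
            (∀ yref wd, QN (err yref wd) = 0) ∧ ErrorConvergesTo sys' ctrl err) ∧
          ((1 : ℂ) ∈ resolventSet ℂ (sys'.evol τ 0) →
            HasApproximateRegulationError sys' ctrl QN)) := by
  obtain ⟨εstar, hεstar, hstable⟩ := mem_nhdsGT_iff_exists_Ioc_subset.1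
    (PeriodicSystem.eventually_powerStable_closedLoopOp hsys.powerStable hK₀)
  refine ⟨εstar, hεstar, fun ε hε₀ hε ctrl hctrl => ?_⟩
  have hG₁ : ctrl.G₁ = ContinuousLinearMap.id ℂ Z := by rw [hctrl]
  have hG₂ (y : L2 τ Y₀) : ctrl.G₂ y = 0 ↔ QN y = 0 := by
    rw [hctrl]
    exact map_eq_zero_iff G₂₀ hG₂₀
  have hnominal : PowerStable (sys.closedLoopOp ctrl) := hctrl ▸ hstable ⟨hε₀, hε⟩
  refine ⟨⟨closedLoopWellPosed sys ctrl, closedLoopStable_iff_powerStable.2 hnominal,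
    hasApproximateRegulationError hsys.powerStable.isUnit_one_sub hG₁ hG₂ hnominal⟩,
    fun sys' hsys' => ?_⟩
  have hperturbed := closedLoopStable_iff_powerStable.1 hsys'
  refine ⟨closedLoopWellPosed sys' ctrl,
    ⟨_, fun yref wd => (hG₂ _).1
      (PeriodicSystem.G₂_asymptoticErrorOp hG₁ hperturbed.isUnit_one_sub (wd.toL2, yref.toL2)),
      errorConvergesTo_asymptoticErrorOp hperturbed⟩, fun hres => ?_⟩
  rw [spectrum.mem_resolventSet_iff, map_one] at hres
  exact hasApproximateRegulationError hres hG₁ hG₂ hperturbed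

end

theorem mainTheorem4 {τ : ℝ} {X U₀ Ud₀ Y₀ : Type*}
    [NormedAddCommGroup X] [NormedSpace ℂ X] [CompleteSpace X]
    [NormedAddCommGroup U₀] [InnerProductSpace ℂ U₀] [CompleteSpace U₀]
    [NormedAddCommGroup Ud₀] [InnerProductSpace ℂ Ud₀] [CompleteSpace Ud₀]
    [NormedAddCommGroup Y₀] [InnerProductSpace ℂ Y₀] [CompleteSpace Y₀]
    (sys : PeriodicSystem τ X U₀ Ud₀ Y₀) (hsys : sys.ExponentiallyStable)
    (YN : Submodule ℂ (L2 τ Y₀)) [FiniteDimensional ℂ YN] (r : ℕ) (hr : r = Module.finrank ℂ YN)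
    (hYN : YN ≤ LinearMap.range (sys.P : L2 τ U₀ →ₗ[ℂ] L2 τ Y₀))
    (QN : L2 τ Y₀ →L[ℂ] YN) (hQN : ∀ y : YN, QN y = y)
    (G₂₀ : YN ≃L[ℂ] EuclideanSpace ℂ (Fin r))
    (K₀ : EuclideanSpace ℂ (Fin r) →L[ℂ] L2 τ U₀)
    (hK₀ : ∀ μ ∈ spectrum ℂ (((G₂₀ : YN →L[ℂ] EuclideanSpace ℂ (Fin r)) ∘L QN) ∘L sys.P ∘L K₀),
      μ.re < 0) :
    ∃ εstar : ℝ, 0 < εstar ∧ ∀ ε : ℝ, 0 < ε → ε ≤ εstar →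
      ∀ ctrl : Controller τ U₀ Y₀ (EuclideanSpace ℂ (Fin r)),
        ctrl = { G₁ := ContinuousLinearMap.id ℂ (EuclideanSpace ℂ (Fin r))
                 G₂ := (G₂₀ : YN →L[ℂ] EuclideanSpace ℂ (Fin r)) ∘L QN
                 K := (ε : ℂ) • K₀ } →
        -- the nominal closed loop: well-posedness, stability, and asymptotic error
        (ClosedLoopWellPosed sys ctrl ∧ ClosedLoopStable sys ctrl ∧
          HasApproximateRegulationError sys ctrl QN) ∧
        -- robustness: perturbed systems for which the closed loop is still exponentially stable
        (∀ sys' : PeriodicSystem τ X U₀ Ud₀ Y₀, ClosedLoopStable sys' ctrl →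
          ClosedLoopWellPosed sys' ctrl ∧
          (∃ err : PeriodicSignal τ Y₀ → PeriodicSignal τ Ud₀ → L2 τ Y₀,
            (∀ yref wd, QN (err yref wd) = 0) ∧ ErrorConvergesTo sys' ctrl err) ∧
          ((1 : ℂ) ∈ resolventSet ℂ (sys'.evol τ 0) →
            HasApproximateRegulationError sys' ctrl QN)) :=
  mainTheorem4_general sys hsys YN QN (G₂₀ : YN →L[ℂ] EuclideanSpace ℂ (Fin r)) G₂₀.injective K₀ hK₀
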